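/- Let $\mathfrak g$ be a finite-dimensional complex simple Lie algebra with Cartan subalgebra $\mathfrak h$, simple roots $\alpha_1,\dots,\alpha_d$, Weyl group $W$ with simple reflections $s_1,\dots,s_d$, integral weight lattice $X\subset\mathfrak h^*$, and let $\rho$ be half the sum of the positive roots. Write $\mathbf i\prec\mathbf j$ if $\mathbf i\ne\mathbf j$ and $\mathbf j-\mathbf i\in\sum_k\mathbb N\alpha_k$. Let $W$ act on $X$ by the dot action $w\cdot\lambda=w(\lambda+\rho)-\rho$. Let $X_{\mathtt f}\subset X$ be a finite subset that is stable under the dot action and contains a regular $W$-orbit (one whose elements have trivial stabilizer for the dot action). Put $\bar X_{\mathtt f}=\{\lambda+\rho:\lambda\in X_{\mathtt f}\}$, with the right $W$-action $\mathbf i w=w^{-1}(\mathbf i)$. Let $\mathcal A=\mathbb Z[q,q^{-1}]$, and let $\mathcal H$ be the Hecke algebra of $W$: the associative unital $\mathcal A$-algebra with generators $H_1,\dots,H_d$ and relations $(H_k-q^{-1})(H_k+q)=0$ for all $k$ and $H_kH_lH_k\cdots=H_lH_kH_l\cdots$ ($m_{kl}$ factors on each side) for $k\neq l$, where $m_{kl}$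 is the order of $s_ks_l$ in $W$. Let $\mathbb T_{\mathtt f}$ be the free $\mathcal A$-module with basis $\{v_{\mathbf i}:\mathbf i\in\bar X_{\mathtt f}\}$. Theorem ($q$-Schur duality). There is a unique right action $\Psi$ of $\mathcal H$ on the $\mathcal A$-module $\mathbb T_{\mathtt f}$ such that for all $\mathbf i\in\bar X_{\mathtt f}$ and $1\le k\le d$ $$v_{\mathbf i}H_k=\begin{cases}q^{-1}v_{\mathbf i},&\mathbf i s_k=\mathbf i,\\ v_{\mathbf i s_k},&\mathbf i s_k\succ\mathbf i,\\ v_{\mathbf i s_k}+(q^{-1}-q)v_{\mathbf i},&\mathbf i s_k\prec\mathbf i.\end{cases}$$ Let $\mathcal S_q=\mathrm{End}_{\mathcal H}(\mathbb T_{\mathtt f})$ be the $q$-Schur algebra, i.e. the algebra of $\mathcal A$-linear endomorphisms of $\mathbb T_{\mathtt f}$ commuting with the action of $\mathcal H$. Then $\mathcal S_q$ and $\mathcal H$ satisfy the double centralizer property $$\mathcal S_q=\mathrm{End}_{\mathcal H}(\mathbb T_{\mathtt f}),\qquad \mathrm{End}_{\mathcal S_q}(\mathbb T_{\mathtt f})=\Psi(\mathcal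 H).$$ Moreover the right action of $\mathcal H$ on $\mathbb T_{\mathtt f}$ is faithful, i.e. $\Psi$ is injective, so that $\Psi(\mathcal H)\cong\mathcal H$. -/

import Mathlib

noncomputable section

open scoped Classical

open Module

namespace QSchur

/-! ### Weights, the Weyl group and the dot action -/

section Weights

variable {ι K M N : Type*} [Finite ι] [Field K] [CharZero K]
  [AddCommGroup M] [Module K M] [AddCommGroup N] [Module K N]

/-- The weight lattice `X`: all `μ` with `⟨μ, α^∨⟩ ∈ ℤ` for every root `α`. -/
def weightLattice (P : RootPairing ι K M N) : Set M :=
  {μ | ∀ i : ι, ∃ n : ℤ, P.toLinearMap μ (P.coroot i) = (n : K)}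

variable {P : RootPairing ι K M N} [P.IsCrystallographic] [P.IsReduced] (b : P.Base)

/-- Half the sum of the positive roots. -/
def rho : M := (2 : K)⁻¹ • ∑ᶠ (i : ι) (_ : b.IsPos i), P.root i

/-- The dot action `w · μ = w (μ + ρ) - ρ` of the Weyl group. -/
def dot (w : P.weylGroup) (μ : M) : M := w • (μ + rho b) - rho b

/-- A set of weights is stable under the dot action. -/
def IsDotInvariant (Xf : Set M) : Prop :=
  ∀ w : P.weylGroup, ∀ μ ∈ Xf, dot b w μ ∈ Xf

/-- The dot orbit of `μ` is regular: the stabilizer of `μ` for the dot action is trivial. -/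
def IsDotRegular (μ : M) : Prop :=
  ∀ w : P.weylGroup, dot b w μ = μ → w = 1

/-- The `ρ`-shifted set `{μ + ρ | μ ∈ Xf}`, on which `W` acts by its usual linear action. -/
def shifted (Xf : Set M) : Set M := {x | ∃ μ ∈ Xf, x = μ + rho b}

variable {b}

set_option linter.unusedSectionVars false in
theorem smul_mem_shifted {Xf : Set M} (hX : IsDotInvariant b Xf) (w : P.weylGroup) {x : M}
    (hx : x ∈ shifted b Xf) : w • x ∈ shifted b Xf := by
  obtain ⟨μ, hμ, rfl⟩ := hx
  exact ⟨dot b w μ, hX w μ hμ, by simp [dot]⟩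

/-- The right action `x w = w⁻¹(x)` of `W` on the shifted set. -/
def rightAct {Xf : Set M} (hX : IsDotInvariant b Xf) (x : shifted b Xf) (w : P.weylGroup) :
    shifted b Xf :=
  ⟨w⁻¹ • (x : M), smul_mem_shifted hX w⁻¹ x.2⟩

variable (b)

/-- The strict order: `x ≺ y` iff `x ≠ y` and `y - x` is a sum of simple roots with
coefficients in `ℕ`. -/
def Prec (x y : M) : Prop :=
  x ≠ y ∧ y - x ∈ AddSubmonoid.closure (P.root '' (b.support : Set ι))

/-- The simple reflection `s_k`. -/
def simpleReflection (k : b.support) : P.weylGroup := RootPairing.weylGroup.ofIdx P (k : ι)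

end Weights

/-! ### The Hecke algebra -/

section Hecke

/-- The ground ring `𝒜 = ℤ[q, q⁻¹]`. -/
abbrev A : Type := LaurentPolynomial ℤ

/-- The indeterminate `q`. -/
def q : A := LaurentPolynomial.T 1

/-- Its inverse `q⁻¹`. -/
def qInv : A := LaurentPolynomial.T (-1)

variable {ι K M N : Type*} [Field K]
  [AddCommGroup M] [Module K M] [AddCommGroup N] [Module K N]
  {P : RootPairing ι K M N} (b : P.Base)

/-- `m_{kl}`, the order of `s_k s_l` in `W`. -/
def m (k l : b.support) : ℕ :=
  orderOf (RootPairing.weylGroup.ofIdx P (k : ι) * RootPairing.weylGroup.ofIdx P (l : ι))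

/-- The product `… x y x y` with `n` factors in the free algebra on the simple reflections. -/
def altProd (k l : b.support) (n : ℕ) : FreeAlgebra A b.support :=
  ((CoxeterSystem.alternatingWord k l n).map (FreeAlgebra.ι A)).prod

/-- The defining relations of the Hecke algebra: the quadratic relations
`(H_k - q⁻¹)(H_k + q) = 0` and the braid relations `H_k H_l H_k ⋯ = H_l H_k H_l ⋯`
(`m_{kl}` factors on each side, `k ≠ l`). -/
inductive HeckeRel : FreeAlgebra A b.support → FreeAlgebra A b.support → Prop
  | quadratic (k : b.support) :
      HeckeRel ((FreeAlgebra.ι A k - algebraMap A _ qInv) * (FreeAlgebra.ι A k + algebraMap A _ q))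
        0
  | braid (k l : b.support) (hkl : k ≠ l) :
      HeckeRel (altProd b k l (m b k l)) (altProd b l k (m b k l))

/-- The Hecke algebra of `W` over `𝒜`. -/
abbrev HeckeAlgebra : Type _ := RingQuot (HeckeRel b)

/-- The generator `H_k`. -/
def H (k : b.support) : HeckeAlgebra b := RingQuot.mkAlgHom A (HeckeRel b) (FreeAlgebra.ι A k)

end Hecke

/-! ### The module `𝕋_f`, the right action of the Hecke algebra and the `q`-Schur algebra -/

section Schur

variable {ι K M N : Type*} [Finite ι] [Field K] [CharZero K]
  [AddCommGroup M] [Module K M] [AddCommGroup N] [Module K N]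
  {P : RootPairing ι K M N} [P.IsCrystallographic] [P.IsReduced] (b : P.Base)

/-- The free `𝒜`-module `𝕋_f` with basis `v_x`, for `x` in the shifted set. -/
abbrev TModule (Xf : Set M) : Type _ := shifted b Xf →₀ A

/-- The standard basis vector `v_x`. -/
def v {Xf : Set M} (x : shifted b Xf) : TModule b Xf := Finsupp.single x 1

/-- The operator `v_x ↦ v_x H_k` on `𝕋_f`:
`q⁻¹ v_x` if `x s_k = x`, `v_{x s_k}` if `x ≺ x s_k`, and `v_{x s_k} + (q⁻¹ - q) v_x` otherwise,
which for integral weights means `x s_k ≺ x`, as `x s_k - x` is an integer multiple of `α_k`. -/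
def heckeOp {Xf : Set M} (hX : IsDotInvariant b Xf) (k : b.support) :
    End A (TModule b Xf) :=
  Finsupp.linearCombination A fun x : shifted b Xf =>
    if rightAct hX x (simpleReflection b k) = x then qInv • v b x
    else if Prec b (x : M) (rightAct hX x (simpleReflection b k) : M) then
      v b (rightAct hX x (simpleReflection b k))
    else v b (rightAct hX x (simpleReflection b k)) + (qInv - q) • v b x

variable {b}

/-- `Ψ` is the right action of the Hecke algebra on `𝕋_f`: it is an algebra homomorphism to the
opposite of `End_𝒜(𝕋_f)`, and the generator `H_k` acts by the operator `heckeOp`. -/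
def IsHeckeAction {Xf : Set M} (hX : IsDotInvariant b Xf)
    (Ψ : HeckeAlgebra b →ₐ[A] (End A (TModule b Xf))ᵐᵒᵖ) : Prop :=
  ∀ k : b.support, Ψ (H b k) = MulOpposite.op (heckeOp b hX k)

/-- The `q`-Schur algebra `𝒮_q = End_ℋ(𝕋_f)`: the `𝒜`-linear endomorphisms of `𝕋_f` that commute
with the right action `Ψ` of every element of the Hecke algebra. -/
def qSchurAlgebra {Xf : Set M} (Ψ : HeckeAlgebra b →ₐ[A] (End A (TModule b Xf))ᵐᵒᵖ) :
    Subalgebra A (End A (TModule b Xf)) :=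
  Subalgebra.centralizer A {f | ∃ h : HeckeAlgebra b, f = (Ψ h).unop}

/-- `End_{𝒮_q}(𝕋_f)`: the endomorphisms of `𝕋_f` that commute with every element of `𝒮_q`. -/
def endOverSchur {Xf : Set M} (Ψ : HeckeAlgebra b →ₐ[A] (End A (TModule b Xf))ᵐᵒᵖ) :
    Subalgebra A (End A (TModule b Xf)) :=
  Subalgebra.centralizer A (qSchurAlgebra Ψ : Set (End A (TModule b Xf)))

end Schur

end QSchur

end

/-!
The module `𝕋_f` is a direct sum over the Weyl group orbits in the shifted set. Let `x` be the
antidominant weight of an orbit (`exists_isAntidominant`). The map `v_w ↦ q^{-e(w)} v_{x w}`, with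
`e(w)` the length of the component of `w` in the stabilizer of `x`, carries the right regular
representation of the Hecke algebra, on the free module with basis `W`, onto that summand
(`orbitMap_rightOp`). Hence the operators on `𝕋_f` satisfy every relation that holds in the regular
representation, and only the latter needs the relations to be verified
(`regularRep_eq_of_heckeRel`). There the braid relations follow from the fact that left and right
multiplication operators commute (`leftOp_rightOp`), so that both sides are determined by their
value at `v_1`, where both give the longest element of a dihedral subgroup.

The elements `H_w`, defined through a choice of reduced words, span the Hecke algebra, because
they do not depend on the choice (`heckeT_eq_of_not_isPos`, Matsumoto's theorem). If the orbit of
`x` is regular then `v_x H_w = v_{x w}`, and these vectors are linearly independent, so the action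
is faithful (`action_injective`).

For the same `x`, the orbit of `x` spans a direct summand of `𝕋_f` that is free of rank one over
the Hecke algebra, with generator `v_x`. So for each `y` some element `φ_y` of the `q`-Schur algebra
sends `v_x` to `y`. If `θ` commutes with the `q`-Schur algebra, and `h` is the element of the Hecke
algebra for which `v_x h` is the component of `θ v_x` in this summand, then
`θ y = θ (φ_y v_x) = φ_y (θ v_x) = φ_y (v_x h) = y h` for all `y` (`endOverSchur_eq`).

All facts on the Weyl group come from its action on roots: lengths are counted by inversions, the
product `w s_k` is longer than `w` precisely when `w α_k` is positive, and `s_k` permutes the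
positive roots other than `α_k`.
-/

noncomputable section

open scoped Classical

open Module

namespace QSchur

set_option linter.unusedSectionVars false

/-! ### The Weyl group and its simple reflections -/

section Roots

variable {ι K M N : Type*} [Field K]
  [AddCommGroup M] [Module K M] [AddCommGroup N] [Module K N]
  {P : RootPairing ι K M N}

theorem root_smul (w : P.weylGroup) (i : ι) : P.root (w • i) = w • P.root i :=
  (P.weylGroup_apply_root w i).symm

theorem toLinearMap_smul_coroot (w : P.weylGroup) (x : M) (i : ι) :
    P.toLinearMap (w • x) (P.coroot (w • i)) = P.toLinearMap x (P.coroot i) := by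
  obtain ⟨w, hw⟩ := w
  have h := LinearMap.congr_fun
    (RootPairing.Hom.weight_coweight_transpose_apply P P (P.coroot (w • i)) w.toHom) x
  have h' := RootPairing.Hom.coroot_coweightMap_apply P P (w • i) w.toHom
  rw [h', show w.toHom.indexEquiv.symm (w • i) = i from w.toHom.indexEquiv.symm_apply_apply i] at h
  exact h

theorem ofIdx_smul_weight (i : ι) (x : M) :
    RootPairing.weylGroup.ofIdx P i • x = x - P.toLinearMap x (P.coroot i) • P.root i := by
  change P.reflection i x = _
  rw [P.reflection_apply]; rfl

theorem weylGroup_ext {w w' : P.weylGroup} (h : ∀ x : M, w • x = w' • x) : w = w' :=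
  Subtype.ext (RootPairing.Equiv.weightHom_injective P (LinearEquiv.ext h))

theorem smul_sub_root (w : P.weylGroup) (x : M) (c : K) (y : M) :
    w • (x - c • y) = w • x - c • (w • y) := by
  change RootPairing.Equiv.weightHom P w (x - c • y) =
    RootPairing.Equiv.weightHom P w x - c • RootPairing.Equiv.weightHom P w y
  rw [map_sub, map_smul]

theorem mul_ofIdx (w : P.weylGroup) (i : ι) :
    w * RootPairing.weylGroup.ofIdx P i = RootPairing.weylGroup.ofIdx P (w • i) * w := by
  refine weylGroup_ext fun x => ?_
  rw [mul_smul, mul_smul, ofIdx_smul_weight, ofIdx_smul_weight, toLinearMap_smul_coroot,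
    smul_sub_root, root_smul]

theorem ofIdx_mul_self (i : ι) :
    RootPairing.weylGroup.ofIdx P i * RootPairing.weylGroup.ofIdx P i = 1 :=
  weylGroup_ext fun x => by
    rw [mul_smul, one_smul]
    exact P.reflection_same i x

variable (b : P.Base)

theorem simpleReflection_smul (k : b.support) (i : ι) :
    simpleReflection b k • i = P.reflectionPerm k i := rfl

@[simp] theorem simpleReflection_mul_self (k : b.support) :
    simpleReflection b k * simpleReflection b k = 1 := ofIdx_mul_self _

@[simp] theorem mul_simpleReflection_mul_self (w : P.weylGroup) (k : b.support) :
    w * simpleReflection b k * simpleReflection b k = w := by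
  rw [mul_assoc, simpleReflection_mul_self, mul_one]

@[simp] theorem simpleReflection_mul_self_mul (w : P.weylGroup) (k : b.support) :
    simpleReflection b k * (simpleReflection b k * w) = w := by
  rw [← mul_assoc, simpleReflection_mul_self, one_mul]

@[simp] theorem simpleReflection_inv (k : b.support) :
    (simpleReflection b k)⁻¹ = simpleReflection b k :=
  inv_eq_of_mul_eq_one_right (simpleReflection_mul_self b k)

theorem simpleReflection_smul_weight (k : b.support) (x : M) :
    simpleReflection b k • x = x - P.toLinearMap x (P.coroot k) • P.root k :=
  ofIdx_smul_weight _ _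

variable {b} in
/-- If `w` carries the simple root `α_k` to `α_l`, then it conjugates `s_k` to `s_l`. -/
theorem mul_simpleReflection_of_smul_eq {w : P.weylGroup} {k l : b.support}
    (h : w • (k : ι) = l) : w * simpleReflection b k = simpleReflection b l * w := by
  rw [simpleReflection, mul_ofIdx, h]; rfl

theorem toLinearMap_simpleReflection_smul (k : b.support) (x : M) (i : ι) :
    P.toLinearMap (simpleReflection b k • x) (P.coroot i) =
      P.toLinearMap x (P.coroot (simpleReflection b k • i)) := by
  rw [← toLinearMap_smul_coroot (simpleReflection b k) x, smul_smul, simpleReflection_mul_self,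
    one_smul]

theorem toLinearMap_coroot_smul (w : P.weylGroup) (x : M) (i : ι) :
    P.toLinearMap x (P.coroot (w • i)) = P.toLinearMap (w⁻¹ • x) (P.coroot i) := by
  rw [← toLinearMap_smul_coroot w (w⁻¹ • x), smul_inv_smul]

/-! ### Positive roots and simple reflections -/

variable [CharZero K]

variable {b} in
theorem isPos_iff_not_of_root_eq_neg {i j : ι} (h : P.root j = -P.root i) :
    b.IsPos j ↔ ¬ b.IsPos i := by
  have := RootPairing.Base.IsPos.neg_iff_not b i
  change b.IsPos (P.reflectionPerm i i) ↔ _ at this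
  rwa [show P.reflectionPerm i i = j from P.root.injective (by
    rw [P.root_reflectionPerm, P.reflection_apply_self, h])] at this

theorem root_simpleReflection_smul_self (k : b.support) :
    P.root (simpleReflection b k • (k : ι)) = -P.root k := by
  rw [root_smul]
  exact P.reflection_apply_self k

theorem isPos_mul_simpleReflection_smul (w : P.weylGroup) (k : b.support) :
    b.IsPos ((w * simpleReflection b k) • (k : ι)) ↔ ¬ b.IsPos (w • (k : ι)) := by
  apply isPos_iff_not_of_root_eq_neg
  rw [mul_smul, root_smul, root_simpleReflection_smul_self, root_smul]
  exact smul_neg _ _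

variable {b} in
theorem height_eq_of_root_eq {i j l : ι} {a c : ℤ}
    (h : P.root l = a • P.root i + c • P.root j) :
    b.height l = a * b.height i + c * b.height j := by
  obtain ⟨f, -, -, hf⟩ := b.exists_root_eq_sum_int i
  obtain ⟨g, -, -, hg⟩ := b.exists_root_eq_sum_int j
  have hfg : P.root l = ∑ t ∈ b.support, (a • f + c • g) t • P.root t := by
    simp_rw [Pi.add_apply, Pi.smul_apply, add_smul, smul_assoc, Finset.sum_add_distrib,
      ← Finset.smul_sum, ← hf, ← hg, h]
  rw [RootPairing.Base.height_eq_sum hf, RootPairing.Base.height_eq_sum hg,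
    RootPairing.Base.height_eq_sum hfg]
  simp [Finset.sum_add_distrib, Finset.mul_sum]

variable [Finite ι] [P.IsCrystallographic] [P.IsReduced] {b}

/-- A simple reflection `s_k` permutes the positive roots other than `α_k`. -/
theorem eq_of_isPos_of_not_isPos {k : b.support} {i : ι} (hi : b.IsPos i)
    (h : ¬ b.IsPos (simpleReflection b k • i)) : i = k := by
  by_contra hne
  exact h (hi.reflectionPerm k.2 hne)

/-- The exchange condition: if the product `w` of a word `a` has the descent `s_k`, then `w s_k` is
the product of a word with fewer letters, obtained from `a` by deleting the letter at which the
successive images of `α_k` become negative. -/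
theorem exists_eraseWord (a : List b.support) (k : b.support)
    (h : ¬ b.IsPos ((a.map (simpleReflection b)).prod • (k : ι))) :
    ∃ a' : List b.support, a'.length < a.length ∧
      (a.map (simpleReflection b)).prod * simpleReflection b k =
        (a'.map (simpleReflection b)).prod := by
  induction a with
  | nil => exact absurd (by simpa using b.isPos_of_mem_support k.2) h
  | cons j a ih =>
    by_cases h' : b.IsPos ((a.map (simpleReflection b)).prod • (k : ι))
    · rw [List.map_cons, List.prod_cons, mul_smul] at h
      have := mul_simpleReflection_of_smul_eq (eq_of_isPos_of_not_isPos h' h)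
      exact ⟨a, by simp, by simp [mul_assoc, this]⟩
    · obtain ⟨a', ha, e⟩ := ih h'
      exact ⟨j :: a', by simpa using ha, by simp [mul_assoc, e]⟩

theorem exists_word (w : P.weylGroup) :
    ∃ a : List b.support, (a.map (simpleReflection b)).prod = w := by
  have key (i : ι) : ∃ a : List b.support,
      (a.map (simpleReflection b)).prod = RootPairing.weylGroup.ofIdx P i := by
    induction i using b.induction_reflect with
    | h₀ i hi =>
      obtain ⟨a, ha⟩ := hi
      refine ⟨a, ha.trans (weylGroup_ext fun x => ?_)⟩
      change P.reflection i x = P.reflection (P.reflectionPerm i i) x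
      rw [P.reflection_reflectionPerm]
      simp
    | h₁ i hi => exact ⟨[⟨i, hi⟩], by simp [simpleReflection]⟩
    | h₂ i j hi hj =>
      obtain ⟨a, ha⟩ := hi
      refine ⟨⟨j, hj⟩ :: (a ++ [⟨j, hj⟩]), ?_⟩
      have e := mul_ofIdx (RootPairing.weylGroup.ofIdx P j) i
      rw [← mul_inv_eq_iff_eq_mul] at e
      simp only [List.map_cons, List.map_append, List.prod_cons, List.prod_append, ha,
        List.map_nil, List.prod_nil, mul_one]
      rw [← mul_assoc]
      refine Eq.trans (congrArg _ ?_) e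
      exact (simpleReflection_inv b ⟨j, hj⟩).symm
  obtain ⟨w, hw⟩ := w
  induction hw using RootPairing.weylGroup.induction with
  | mem i => exact key i
  | one => exact ⟨[], rfl⟩
  | mul x y hx hy h1 h2 =>
    obtain ⟨a, ha⟩ := h1
    obtain ⟨c, hc⟩ := h2
    exact ⟨a ++ c, by rw [List.map_append, List.prod_append, ha, hc]; rfl⟩

/-- A nontrivial element of the Weyl group has a descent: it sends some simple root to a negative
root. -/
theorem exists_descent {w : P.weylGroup} (hw : w ≠ 1) :
    ∃ k : b.support, ¬ b.IsPos (w • (k : ι)) := by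
  have hex : ∃ n, ∃ a : List b.support, a.length = n ∧ (a.map (simpleReflection b)).prod = w :=
    (exists_word (b := b) w).elim fun a ha => ⟨_, a, rfl, ha⟩
  obtain ⟨a, ha, e⟩ := Nat.find_spec hex
  have hmin : ∀ c : List b.support, (c.map (simpleReflection b)).prod = w →
      a.length ≤ c.length := fun c hc => ha ▸ Nat.find_min' hex ⟨c, rfl, hc⟩
  rcases List.eq_nil_or_concat a with rfl | ⟨a₀, k, rfl⟩
  · exact absurd (by simpa using e.symm) hw
  · simp only [List.concat_eq_append, List.map_append, List.map_cons, List.map_nil,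
      List.prod_append, List.prod_singleton, List.length_append, List.length_singleton] at e hmin
    refine ⟨k, ?_⟩
    rw [← e, isPos_mul_simpleReflection_smul, not_not]
    by_contra h
    obtain ⟨c, hc, hc'⟩ := exists_eraseWord a₀ k h
    have := hmin c (hc' ▸ e)
    omega

theorem eq_one_of_forall_isPos {w : P.weylGroup} (h : ∀ k : b.support, b.IsPos (w • (k : ι))) :
    w = 1 := by
  by_contra hw
  obtain ⟨k, hk⟩ := exists_descent (b := b) hw
  exact hk (h k)

theorem weylGroup_induction {p : P.weylGroup → Prop} (one : p 1)
    (mul : ∀ (k : b.support) (w : P.weylGroup), p w → p (simpleReflection b k * w))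
    (w : P.weylGroup) : p w := by
  obtain ⟨a, rfl⟩ := exists_word (b := b) w
  induction a with
  | nil => simpa using one
  | cons k a ih => simpa using mul k _ ih

/-! ### Dihedral subgroups -/

variable (b) in
/-- The product `⋯ s_l s_k s_l` with `n` factors in the Weyl group. -/
def altWeyl (k l : b.support) (n : ℕ) : P.weylGroup :=
  ((CoxeterSystem.alternatingWord k l n).map (simpleReflection b)).prod

@[simp] theorem altWeyl_zero (k l : b.support) : altWeyl b k l 0 = 1 := rfl

theorem altWeyl_succ (k l : b.support) (n : ℕ) :
    altWeyl b k l (n + 1) = altWeyl b l k n * simpleReflection b l := by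
  simp [altWeyl, CoxeterSystem.alternatingWord_succ]

theorem altWeyl_succ' (k l : b.support) (n : ℕ) :
    altWeyl b k l (n + 1) =
      simpleReflection b (if Even n then l else k) * altWeyl b k l n := by
  simp [altWeyl, CoxeterSystem.alternatingWord_succ']

theorem altWeyl_inv_mul (k l : b.support) (n : ℕ) :
    (altWeyl b l k n)⁻¹ * altWeyl b k l n =
      (simpleReflection b k * simpleReflection b l) ^ n := by
  induction n generalizing k l with
  | zero => simp
  | succ n ih =>
    have := ih l k
    rw [altWeyl_succ, altWeyl_succ, mul_inv_rev, simpleReflection_inv, mul_assoc,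
      ← mul_assoc (altWeyl b k l n)⁻¹, this, ← mul_assoc]
    exact (SemiconjBy.pow_right (show SemiconjBy (simpleReflection b k)
      (simpleReflection b l * simpleReflection b k) (simpleReflection b k * simpleReflection b l)
      from (mul_assoc _ _ _).symm) n).eq ▸ by rw [mul_assoc, pow_succ]

theorem altWeyl_inv (k l : b.support) (n : ℕ) :
    (altWeyl b k l n)⁻¹ = if Even n then altWeyl b l k n else altWeyl b k l n := by
  induction n generalizing k l with
  | zero => simp
  | succ n ih =>
    rw [altWeyl_succ, mul_inv_rev, simpleReflection_inv, ih l k]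
    by_cases h : Even n
    · rw [if_pos h, if_neg (by simpa [Nat.even_add_one] using h), ← altWeyl_succ, altWeyl_succ',
        if_pos h]
    · rw [if_neg h, if_pos (by simpa [Nat.even_add_one] using h), altWeyl_succ', if_neg h]

/-- The two alternating words with `m_{kl}` letters have the same product. -/
theorem altWeyl_order (k l : b.support) : altWeyl b k l (m b k l) = altWeyl b l k (m b k l) := by
  have := altWeyl_inv_mul k l (m b k l)
  rw [show (simpleReflection b k * simpleReflection b l) ^ m b k l = 1 from pow_orderOf_eq_one _,
    inv_mul_eq_one] at this
  exact this.symm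

theorem m_comm (k l : b.support) : m b k l = m b l k := by
  have h := orderOf_inv (simpleReflection b k * simpleReflection b l)
  rw [mul_inv_rev, simpleReflection_inv, simpleReflection_inv] at h
  exact h.symm

/-- Alternating words with at most `m_{kl}` letters are reduced. If `⋯ s_k s_l` with `n` letters
were the first to send `α_k` to a negative root, the two alternating words with `n` letters would
have the same product, so that `(s_k s_l) ^ n = 1`. -/
theorem isPos_altWeyl_smul (k l : b.support) {n : ℕ} (hn : n < m b k l) :
    b.IsPos (altWeyl b k l n • (k : ι)) := by
  induction n with
  | zero => simpa using b.isPos_of_mem_support k.2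
  | succ n ih =>
    by_contra h
    rw [altWeyl_succ', mul_smul] at h
    have e := mul_simpleReflection_of_smul_eq (eq_of_isPos_of_not_isPos (ih (by omega)) h)
    rw [← altWeyl_succ, ← altWeyl_succ'] at e
    have := altWeyl_inv_mul k l (n + 1)
    rw [e, inv_mul_cancel] at this
    exact absurd (Nat.le_of_dvd n.succ_pos (orderOf_dvd_of_pow_eq_one this.symm)) (by
      rw [m, ← simpleReflection] at hn
      exact not_le.mpr hn)

theorem exists_root_simpleReflection_smul (k : b.support) (i : ι) :
    ∃ z : ℤ, P.root (simpleReflection b k • i) = P.root i + z • P.root k := by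
  refine ⟨-P.pairingIn ℤ i k, ?_⟩
  rw [neg_smul, ← sub_eq_add_neg]
  exact (P.root_reflectionPerm k i).trans (P.reflection_apply_root' ℤ)

theorem exists_root_altWeyl_smul (k l : b.support) (n : ℕ) :
    ∃ a c : ℤ, P.root (altWeyl b k l n • (k : ι)) = a • P.root k + c • P.root l := by
  induction n with
  | zero => exact ⟨1, 0, by simp⟩
  | succ n ih =>
    obtain ⟨a, c, h⟩ := ih
    rw [altWeyl_succ', mul_smul]
    obtain ⟨z, hz⟩ := exists_root_simpleReflection_smul (if Even n then l else k)
      (altWeyl b k l n • (k : ι))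
    rw [hz, h]
    split_ifs
    · exact ⟨a, c + z, by module⟩
    · exact ⟨a + z, c, by module⟩

/-- The root `⋯ s_k s_l (α_k)`, with fewer than `m_{kl}` reflections, is a combination of `α_k`
and `α_l` with nonnegative coefficients. -/
theorem exists_root_altWeyl_smul_nonneg {k l : b.support} (hkl : k ≠ l) {n : ℕ}
    (hn : n < m b k l) :
    ∃ a c : ℤ, 0 ≤ a ∧ 0 ≤ c ∧
      P.root (altWeyl b k l n • (k : ι)) = a • P.root k + c • P.root l := by
  obtain ⟨a, c, h⟩ := exists_root_altWeyl_smul k l n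
  have hkl' : (k : ι) ≠ l := fun e => hkl (Subtype.ext e)
  have hsum : ∑ j ∈ b.support, (Pi.single (k : ι) a + Pi.single (l : ι) c : ι → ℤ) j • P.root j =
      a • P.root k + c • P.root l := by
    simp [add_smul, Finset.sum_add_distrib, Pi.single_apply, ite_smul]
  have hpos := isPos_altWeyl_smul k l hn
  rcases b.pos_or_neg_of_sum_smul_root_mem (Pi.single (k : ι) a + Pi.single (l : ι) c)
    ⟨_, h.trans hsum.symm⟩ (by
      intro j hj
      by_contra hj'
      have h1 : j ≠ k := fun e => hj' (e ▸ k.2)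
      have h2 : j ≠ l := fun e => hj' (e ▸ l.2)
      simp [h1, h2] at hj) with h' | h'
  · exact ⟨a, c, by simpa [hkl'] using h'.le (k : ι), by simpa [hkl'.symm] using h'.le (l : ι), h⟩
  · have ha : a ≤ 0 := by simpa [hkl'] using h'.le (k : ι)
    have hc : c ≤ 0 := by simpa [hkl'.symm] using h'.le (l : ι)
    rw [RootPairing.Base.isPos_iff, height_eq_of_root_eq h, b.height_one_of_mem_support k.2,
      b.height_one_of_mem_support l.2] at hpos
    omega

theorem root_mul_altWeyl_smul {u : P.weylGroup} {k l : b.support} {n : ℕ} {a c : ℤ}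
    (h : P.root (altWeyl b k l n • (k : ι)) = a • P.root k + c • P.root l) :
    P.root ((u * altWeyl b k l n) • (k : ι)) =
      a • P.root (u • (k : ι)) + c • P.root (u • (l : ι)) := by
  rw [mul_smul, root_smul, h, root_smul, root_smul]
  change RootPairing.Equiv.weightHom P u _ = a • RootPairing.Equiv.weightHom P u _ +
    c • RootPairing.Equiv.weightHom P u _
  rw [map_add, map_zsmul, map_zsmul]

/-- If `u` has no descent among `s_k, s_l`, then neither has `u ⋯ s_k s_l` the descent `s_k`, for
an alternating word with fewer than `m_{kl}` letters. -/
theorem isPos_mul_altWeyl_smul {u : P.weylGroup} {k l : b.support} (hkl : k ≠ l)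
    (hk : b.IsPos (u • (k : ι))) (hl : b.IsPos (u • (l : ι))) {n : ℕ} (hn : n < m b k l) :
    b.IsPos ((u * altWeyl b k l n) • (k : ι)) := by
  obtain ⟨a, c, ha, hc, h⟩ := exists_root_altWeyl_smul_nonneg hkl hn
  rw [RootPairing.Base.isPos_iff'] at hk hl ⊢
  rw [height_eq_of_root_eq (root_mul_altWeyl_smul h)]
  positivity

theorem not_isPos_mul_altWeyl_smul {u : P.weylGroup} {k l : b.support} (hkl : k ≠ l)
    (hk : ¬ b.IsPos (u • (k : ι))) (hl : ¬ b.IsPos (u • (l : ι))) {n : ℕ} (hn : n < m b k l) :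
    ¬ b.IsPos ((u * altWeyl b k l n) • (k : ι)) := by
  obtain ⟨a, c, ha, hc, h⟩ := exists_root_altWeyl_smul_nonneg hkl hn
  rw [RootPairing.Base.isPos_iff, not_lt] at hk hl ⊢
  rw [height_eq_of_root_eq (root_mul_altWeyl_smul h)]
  nlinarith [mul_nonneg ha (neg_nonneg.mpr hk), mul_nonneg hc (neg_nonneg.mpr hl)]

theorem finite_weylGroup (b : P.Base) : Finite P.weylGroup := by
  refine Finite.of_injective P.weylGroupToPerm ((injective_iff_map_eq_one _).mpr fun w hw => ?_)
  refine eq_one_of_forall_isPos (b := b) fun k => ?_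
  rw [show w • (k : ι) = k from Equiv.congr_fun hw k]
  exact b.isPos_of_mem_support k.2

theorem m_pos (k l : b.support) : 0 < m b k l :=
  haveI := finite_weylGroup b
  orderOf_pos _

/-- If `s_k` and `s_l` are descents of `w`, then `w` factors as the product of an element without
descents among `s_k, s_l` and of the longest element `⋯ s_l s_k s_l` (with `m_{kl}` factors) of the
subgroup generated by `s_k, s_l`. -/
theorem exists_eq_mul_altWeyl {w : P.weylGroup} {k l : b.support} (hkl : k ≠ l)
    (hk : ¬ b.IsPos (w • (k : ι))) (hl : ¬ b.IsPos (w • (l : ι))) :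
    ∃ u : P.weylGroup, b.IsPos (u • (k : ι)) ∧ b.IsPos (u • (l : ι)) ∧
      w = u * altWeyl b k l (m b k l) := by
  have key (k l : b.support) (hkl : k ≠ l) (hk : ¬ b.IsPos (w • (k : ι)))
      (hl : ¬ b.IsPos (w • (l : ι))) : b.IsPos ((w * altWeyl b k l (m b k l)) • (l : ι)) := by
    obtain ⟨n, hn⟩ := Nat.exists_eq_add_one.mpr (m_pos k l)
    rw [hn, altWeyl_succ, ← mul_assoc, isPos_mul_simpleReflection_smul]
    exact not_isPos_mul_altWeyl_smul hkl.symm hl hk (by rw [m_comm l k, hn]; exact n.lt_succ_self)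
  refine ⟨w * altWeyl b k l (m b k l), ?_, key k l hkl hk hl, ?_⟩
  · rw [altWeyl_order, m_comm k l]
    exact key l k hkl.symm hl hk
  · have h : (altWeyl b k l (m b k l))⁻¹ = altWeyl b k l (m b k l) := by
      rw [altWeyl_inv, ← altWeyl_order, ite_self]
    rw [mul_assoc]
    nth_rw 1 [← h]
    simp

/-! ### Inversions -/

variable (b) in
/-- The number of positive roots in `S` that `w⁻¹` makes negative. For the set `S` of all roots this
is the length of `w`; for the set of roots orthogonal to an antidominant weight it is the length of
the component of `w` in the stabilizer of that weight. -/
def invCount (S : Set ι) (w : P.weylGroup) : ℕ :=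
  {i | i ∈ S ∧ b.IsPos i ∧ ¬ b.IsPos (w⁻¹ • i)}.ncard

theorem isPos_simpleReflection_smul_iff {k : b.support} {i : ι} (h1 : i ≠ k)
    (h2 : P.root i ≠ -P.root k) : b.IsPos (simpleReflection b k • i) ↔ b.IsPos i := by
  constructor
  · intro h
    by_contra hi
    have := eq_of_isPos_of_not_isPos h (by rwa [smul_smul, simpleReflection_mul_self, one_smul])
    refine h2 ?_
    rw [← root_simpleReflection_smul_self, ← this, smul_smul, simpleReflection_mul_self, one_smul]
  · intro h
    by_contra hi
    exact h1 (eq_of_isPos_of_not_isPos h hi)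

theorem invCount_mul_simpleReflection (S : Set ι) {w : P.weylGroup} {k : b.support}
    (h : b.IsPos (w • (k : ι))) :
    invCount b S (w * simpleReflection b k) =
      invCount b S w + if w • (k : ι) ∈ S then 1 else 0 := by
  have key (i : ι) : (b.IsPos i ∧ ¬ b.IsPos ((w * simpleReflection b k)⁻¹ • i)) ↔
      i = w • (k : ι) ∨ (b.IsPos i ∧ ¬ b.IsPos (w⁻¹ • i)) := by
    rw [mul_inv_rev, simpleReflection_inv, mul_smul]
    by_cases h1 : w⁻¹ • i = k
    · have hi : i = w • (k : ι) := by rw [← h1, smul_inv_smul]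
      have hneg : ¬ b.IsPos (simpleReflection b k • (k : ι)) := by
        rw [isPos_iff_not_of_root_eq_neg (root_simpleReflection_smul_self b k), not_not]
        exact b.isPos_of_mem_support k.2
      rw [h1]
      simp [hi, h, hneg]
    · have hi : i ≠ w • (k : ι) := fun e => h1 (by rw [e, inv_smul_smul])
      by_cases h2 : P.root (w⁻¹ • i) = -P.root k
      · have hi' : P.root i = -P.root (w • (k : ι)) := by
          rw [← smul_inv_smul w i, root_smul, h2, root_smul]
          exact smul_neg _ _
        have : ¬ b.IsPos i := by rw [isPos_iff_not_of_root_eq_neg hi', not_not]; exact h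
        simp [this, hi]
      · rw [isPos_simpleReflection_smul_iff h1 h2]
        simp [hi]
  have hnot : ¬ (b.IsPos (w • (k : ι)) ∧ ¬ b.IsPos (w⁻¹ • w • (k : ι))) := by
    rw [inv_smul_smul]
    exact fun h' => h'.2 (b.isPos_of_mem_support k.2)
  unfold invCount
  simp_rw [key]
  split_ifs with hS
  · rw [← Set.ncard_insert_of_notMem (a := w • (k : ι)) (fun h' => hnot h'.2) (Set.toFinite _)]
    congr 1
    ext i
    simp only [Set.mem_ofPred_eq, Set.mem_insert_iff]
    constructor
    · tauto
    · rintro (rfl | h') <;> tauto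
  · congr 1
    ext i
    simp only [Set.mem_ofPred_eq]
    constructor
    · rintro ⟨h1, rfl | h2⟩ <;> tauto
    · tauto

/-! ### Positive coroots and antidominant weights -/

/-- A coroot is positive precisely when its root is: both notions change under `s_k` only
for `± α_k`. -/
theorem isPos_flip_iff (i : ι) : b.flip.IsPos i ↔ b.IsPos i := by
  have hneg (c : P.flip.Base) {i j : ι} (h : P.coroot j = -P.coroot i) :
      c.IsPos j ↔ ¬ c.IsPos i := isPos_iff_not_of_root_eq_neg (P := P.flip) h
  have hself (j : ι) : P.root (P.reflectionPerm j j) = -P.root j := by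
    rw [P.root_reflectionPerm, P.reflection_apply_self]
  have hself' (j : ι) : P.coroot (P.reflectionPerm j j) = -P.coroot j := by
    rw [P.coroot_reflectionPerm, P.coreflection_apply_self]
  have hflip (i : ι) (hi : b.flip.IsPos i ↔ b.IsPos i) :
      b.flip.IsPos (P.reflectionPerm i i) ↔ b.IsPos (P.reflectionPerm i i) := by
    rw [hneg b.flip (hself' i), isPos_iff_not_of_root_eq_neg (hself i), hi]
  have hpos {i j : ι} (hi : b.flip.IsPos i ↔ b.IsPos i) (hj : j ∈ b.support) (hp : b.IsPos i) :
      b.flip.IsPos (P.reflectionPerm j i) ↔ b.IsPos (P.reflectionPerm j i) := by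
    by_cases hij : i = j
    · subst hij
      exact hflip i hi
    · exact iff_of_true ((hi.mpr hp).reflectionPerm (b := b.flip) hj hij)
        (hp.reflectionPerm hj hij)
  induction i using b.induction_reflect with
  | h₀ i hi => exact hflip i hi
  | h₁ i hi => exact iff_of_true (b.flip.isPos_of_mem_support hi) (b.isPos_of_mem_support hi)
  | h₂ i j hi hj =>
    by_cases hp : b.IsPos i
    · exact hpos hi hj hp
    · have h := hpos (hflip i hi) hj ((isPos_iff_not_of_root_eq_neg (hself i)).mpr hp)
      rwa [hneg b.flip (i := P.reflectionPerm j i) (by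
          rw [P.coroot_reflectionPerm, hself', map_neg, P.coroot_reflectionPerm]),
        isPos_iff_not_of_root_eq_neg (b := b) (i := P.reflectionPerm j i) (by
          rw [P.root_reflectionPerm, hself, map_neg, P.root_reflectionPerm]), not_iff_not] at h

variable (b) in
/-- A weight is antidominant if its pairing with every positive coroot is an integer `≤ 0`. -/
def IsAntidominant (x : M) : Prop :=
  ∀ i, b.IsPos i → ∃ n : ℤ, n ≤ 0 ∧ P.toLinearMap x (P.coroot i) = n

theorem isAntidominant_of_simple {x : M}
    (h : ∀ k : b.support, ∃ n : ℤ, n ≤ 0 ∧ P.toLinearMap x (P.coroot k) = n) :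
    IsAntidominant b x := by
  intro i hi
  refine ((isPos_flip_iff i).mpr hi).induction_on_add
    (p := fun i => ∃ n : ℤ, n ≤ 0 ∧ P.toLinearMap x (P.coroot i) = n) (fun i hi => h ⟨i, hi⟩) ?_
  rintro i j l e ⟨n, hn, hn'⟩ hj
  obtain ⟨n', hn2, hn2'⟩ := h ⟨j, hj⟩
  refine ⟨n + n', by omega, ?_⟩
  rw [show P.coroot l = P.coroot i + P.coroot j from e, map_add, hn', hn2']
  simp

theorem mem_weightLattice_of_simple {x : M}
    (h : ∀ k : b.support, ∃ n : ℤ, P.toLinearMap x (P.coroot k) = n) : x ∈ weightLattice P := by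
  intro i
  refine Submodule.span_induction (p := fun y _ => ∃ n : ℤ, P.toLinearMap x y = n) ?_ ?_ ?_ ?_
    (b.coroot_mem_span_int i)
  · rintro _ ⟨k, hk, rfl⟩
    exact h ⟨k, hk⟩
  · exact ⟨0, by simp⟩
  · rintro y z - - ⟨n, hn⟩ ⟨n', hn'⟩
    exact ⟨n + n', by rw [map_add, hn, hn']; simp⟩
  · rintro c y - ⟨n, hn⟩
    exact ⟨c * n, by rw [map_zsmul, hn]; simp⟩

theorem smul_mem_weightLattice {x : M} (hx : x ∈ weightLattice P) (w : P.weylGroup) :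
    w • x ∈ weightLattice P := fun i => by
  rw [← inv_inv w, ← toLinearMap_coroot_smul]
  exact hx _

/-- Every Weyl group orbit of integral weights contains an antidominant weight: one that has the
least number of positive coroots with positive pairing. -/
theorem exists_isAntidominant {x : M} (hx : x ∈ weightLattice P) :
    ∃ w : P.weylGroup, IsAntidominant b (w • x) := by
  let B (w : P.weylGroup) : Set ι :=
    {i | b.IsPos i ∧ ∃ n : ℤ, 0 < n ∧ P.toLinearMap (w • x) (P.coroot i) = n}
  let w := Function.argmin fun w => (B w).ncard
  refine ⟨w, isAntidominant_of_simple fun k => ?_⟩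
  obtain ⟨n, hn⟩ := smul_mem_weightLattice hx w k
  refine ⟨n, ?_, hn⟩
  by_contra! hpos
  -- Otherwise `s_k` maps `B (s_k w)` injectively to `B w`, missing `k`.
  have hk : (k : ι) ∈ B w := ⟨b.isPos_of_mem_support k.2, n, hpos, hn⟩
  have hlt : (B (simpleReflection b k * w)).ncard < (B w).ncard := by
    rw [← Set.ncard_image_of_injective _ (MulAction.injective (simpleReflection b k))]
    refine Set.ncard_lt_ncard ⟨?_, fun hsub => ?_⟩ (Set.toFinite _)
    · rintro _ ⟨i, ⟨hi, n', hn', e⟩, rfl⟩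
      rw [mul_smul, toLinearMap_simpleReflection_smul] at e
      refine ⟨?_, n', hn', e⟩
      by_contra h
      obtain rfl := eq_of_isPos_of_not_isPos hi h
      have h' : P.coroot (simpleReflection b k • (k : ι)) = -P.coroot k := by
        rw [simpleReflection_smul, P.coroot_reflectionPerm, P.coreflection_apply_self]
      rw [h', map_neg, hn] at e
      norm_cast at e
      omega
    · obtain ⟨i, ⟨hi, -⟩, e⟩ := hsub hk
      have : simpleReflection b k • (k : ι) = i := by
        rw [← e, smul_smul, simpleReflection_mul_self, one_smul]
      rw [← this, isPos_iff_not_of_root_eq_neg (root_simpleReflection_smul_self b k)] at hi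
      exact hi (b.isPos_of_mem_support k.2)
  exact Function.not_lt_argmin (fun w => (B w).ncard) _ hlt

/-- The weight `ρ` pairs to `1` with the simple coroots: `s_k` permutes the positive roots other
than `α_k`, so these contribute `0` to `⟨2ρ, α_k^∨⟩`. -/
theorem toLinearMap_rho (k : b.support) : P.toLinearMap (rho b) (P.coroot k) = 1 := by
  have := Fintype.ofFinite ι
  have hsum : ∑ᶠ (i : ι) (_ : b.IsPos i), P.root i =
      ∑ i with b.IsPos i, P.root i := by
    rw [finsum_eq_sum_of_fintype, Finset.sum_filter]
    exact Finset.sum_congr rfl fun i _ => finsum_eq_if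
  have hk : (k : ι) ∈ Finset.univ.filter fun i => b.IsPos i := by
    simpa using b.isPos_of_mem_support k.2
  have hrest : ∑ i ∈ (Finset.univ.filter fun i => b.IsPos i).erase k,
      P.toLinearMap (P.root i) (P.coroot k) = 0 := by
    rw [← self_eq_neg, ← Finset.sum_neg_distrib]
    have hmem (i : ι) (hi : i ∈ (Finset.univ.filter fun i => b.IsPos i).erase (k : ι)) :
        P.reflectionPerm k i ∈ (Finset.univ.filter fun i => b.IsPos i).erase (k : ι) := by
      simp only [Finset.mem_erase, Finset.mem_filter, Finset.mem_univ, true_and] at hi ⊢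
      refine ⟨fun e => ?_, hi.2.reflectionPerm k.2 hi.1⟩
      have h1 := root_simpleReflection_smul_self b k
      rw [simpleReflection_smul,
        (congrArg (P.reflectionPerm k) e).symm.trans (P.reflectionPerm_self k i)] at h1
      exact (isPos_iff_not_of_root_eq_neg h1).mp hi.2 (b.isPos_of_mem_support k.2)
    refine Finset.sum_nbij' (P.reflectionPerm k) (P.reflectionPerm k) hmem hmem
      (fun i _ => P.reflectionPerm_self k i) (fun i _ => P.reflectionPerm_self k i) fun i _ => ?_
    have := toLinearMap_simpleReflection_smul b k (P.root i) k
    rw [← root_smul, simpleReflection_smul, simpleReflection_smul, P.coroot_reflectionPerm,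
      P.coreflection_apply_self, map_neg] at this
    rw [this, neg_neg]
  rw [rho, hsum, map_smul, map_sum, LinearMap.smul_apply, LinearMap.sum_apply,
    ← Finset.add_sum_erase _ _ hk, hrest, P.root_coroot_two]
  simp

end Roots

/-! ### Intertwining maps -/

section Intertwine

variable {S V V' : Type*} [AddCommGroup V] [Module A V] [AddCommGroup V'] [Module A V']

/-- A linear map that intertwines the generators of two right actions of a free algebra intertwines
the actions. -/
theorem lift_intertwine {f : S → (End A V)ᵐᵒᵖ} {f' : S → (End A V')ᵐᵒᵖ} {π : V →ₗ[A] V'}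
    (h : ∀ k v, π ((f k).unop v) = (f' k).unop (π v)) (a : FreeAlgebra A S) (v : V) :
    π ((FreeAlgebra.lift A f a).unop v) = (FreeAlgebra.lift A f' a).unop (π v) := by
  induction a generalizing v with
  | grade0 r => simp [MulOpposite.algebraMap_apply, Module.algebraMap_end_apply]
  | grade1 k => simpa using h k v
  | mul a c ha hc => simp [ha, hc]
  | add a c ha hc => simp [ha, hc]

theorem qInv_mul_q : qInv * q = 1 := by
  rw [q, qInv, ← LaurentPolynomial.T_add, neg_add_cancel, LaurentPolynomial.T_zero]

end Intertwine

/-! ### The regular representation of the Hecke algebra -/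

section Regular

variable {ι K M N : Type*} [Field K]
  [AddCommGroup M] [Module K M] [AddCommGroup N] [Module K N]
  {P : RootPairing ι K M N} (b : P.Base) [CharZero K]

/-- The operator `v_w ↦ v_w H_k` of the right regular representation, on the free module with basis
the Weyl group. The length of `w s_k` exceeds that of `w` precisely when `w α_k` is positive. -/
def rightOp (k : b.support) : End A (P.weylGroup →₀ A) :=
  Finsupp.linearCombination A fun w : P.weylGroup =>
    if b.IsPos (w • (k : ι)) then Finsupp.single (w * simpleReflection b k) 1
    else Finsupp.single (w * simpleReflection b k) 1 + (qInv - q) • Finsupp.single w 1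

/-- The operator `v_w ↦ H_k v_w` of the left regular representation. -/
def leftOp (k : b.support) : End A (P.weylGroup →₀ A) :=
  Finsupp.linearCombination A fun w : P.weylGroup =>
    if b.IsPos (w⁻¹ • (k : ι)) then Finsupp.single (simpleReflection b k * w) 1
    else Finsupp.single (simpleReflection b k * w) 1 + (qInv - q) • Finsupp.single w 1

variable {b}

theorem rightOp_single_of_isPos {k : b.support} {w : P.weylGroup} (h : b.IsPos (w • (k : ι))) :
    rightOp b k (Finsupp.single w 1) = Finsupp.single (w * simpleReflection b k) 1 := by
  simp [rightOp, h]

theorem rightOp_single_of_not_isPos {k : b.support} {w : P.weylGroup}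
    (h : ¬ b.IsPos (w • (k : ι))) :
    rightOp b k (Finsupp.single w 1) =
      Finsupp.single (w * simpleReflection b k) 1 + (qInv - q) • Finsupp.single w 1 := by
  simp only [rightOp, Finsupp.linearCombination_single, h, if_false, one_smul]

theorem leftOp_single_of_isPos {k : b.support} {w : P.weylGroup} (h : b.IsPos (w⁻¹ • (k : ι))) :
    leftOp b k (Finsupp.single w 1) = Finsupp.single (simpleReflection b k * w) 1 := by
  simp [leftOp, h]

theorem leftOp_single_of_not_isPos {k : b.support} {w : P.weylGroup}
    (h : ¬ b.IsPos (w⁻¹ • (k : ι))) :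
    leftOp b k (Finsupp.single w 1) =
      Finsupp.single (simpleReflection b k * w) 1 + (qInv - q) • Finsupp.single w 1 := by
  simp only [leftOp, Finsupp.linearCombination_single, h, if_false, one_smul]

theorem rightOp_rightOp (k : b.support) (v : P.weylGroup →₀ A) :
    rightOp b k (rightOp b k v) = v + (qInv - q) • rightOp b k v := by
  suffices rightOp b k ∘ₗ rightOp b k = LinearMap.id + (qInv - q) • rightOp b k from
    LinearMap.congr_fun this v
  refine Finsupp.lhom_ext' fun w => LinearMap.ext_ring ?_
  have h2 := isPos_mul_simpleReflection_smul b w k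
  by_cases h : b.IsPos (w • (k : ι))
  · simp only [LinearMap.comp_apply, Finsupp.lsingle_apply, LinearMap.add_apply, LinearMap.id_apply,
      LinearMap.smul_apply, rightOp_single_of_isPos h,
      rightOp_single_of_not_isPos (h2.not.mpr (not_not.mpr h)), mul_simpleReflection_mul_self]
  · simp only [LinearMap.comp_apply, Finsupp.lsingle_apply, LinearMap.add_apply, LinearMap.id_apply,
      LinearMap.smul_apply, rightOp_single_of_not_isPos h, map_add, map_smul,
      rightOp_single_of_isPos (h2.mpr h), mul_simpleReflection_mul_self]

variable [Finite ι] [P.IsCrystallographic] [P.IsReduced]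

theorem isPos_inv_simpleReflection_mul_smul (w : P.weylGroup) (l : b.support) :
    b.IsPos ((simpleReflection b l * w)⁻¹ • (l : ι)) ↔ ¬ b.IsPos (w⁻¹ • (l : ι)) := by
  rw [mul_inv_rev, simpleReflection_inv, isPos_mul_simpleReflection_smul]

/-- Left and right multiplication operators commute. The only interaction of the two case
distinctions is for `w α_k = ± α_l`, and then `s_l w = w s_k`. -/
theorem leftOp_rightOp (k l : b.support) (v : P.weylGroup →₀ A) :
    leftOp b l (rightOp b k v) = rightOp b k (leftOp b l v) := by
  suffices leftOp b l ∘ₗ rightOp b k = rightOp b k ∘ₗ leftOp b l from LinearMap.congr_fun this v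
  refine Finsupp.lhom_ext' fun w => LinearMap.ext_ring ?_
  simp only [LinearMap.comp_apply, Finsupp.lsingle_apply]
  by_cases hc : simpleReflection b l * w = w * simpleReflection b k ∧
      (b.IsPos (w • (k : ι)) ↔ b.IsPos (w⁻¹ • (l : ι)))
  · -- Here both operators restrict to the same operator on the span of `v_w` and `v_{s_l w}`.
    obtain ⟨e, hc⟩ := hc
    have h1 := isPos_mul_simpleReflection_smul b w k
    have h2 := isPos_inv_simpleReflection_mul_smul w l
    have e' : simpleReflection b l * (w * simpleReflection b k) = w := by
      rw [← e, simpleReflection_mul_self_mul]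
    by_cases h : b.IsPos (w • (k : ι))
    · have h' := hc.mp h
      rw [rightOp_single_of_isPos h, leftOp_single_of_isPos h', e,
        rightOp_single_of_not_isPos (h1.not.mpr (not_not.mpr h)),
        leftOp_single_of_not_isPos (by rw [← e]; exact h2.not.mpr (not_not.mpr h')), e',
        mul_simpleReflection_mul_self]
    · have h' := hc.not.mp h
      rw [rightOp_single_of_not_isPos h, leftOp_single_of_not_isPos h', e, map_add, map_add,
        map_smul, map_smul, rightOp_single_of_isPos (h1.mpr h),
        leftOp_single_of_isPos (by rw [← e]; exact h2.mpr h'), e',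
        mul_simpleReflection_mul_self, rightOp_single_of_not_isPos h,
        leftOp_single_of_not_isPos h', e]
  · -- Here `w α_k ≠ ± α_l`, so the conditions on `k` and `l` do not interact.
    have hne : w • (k : ι) ≠ l := fun h => hc
      ⟨(mul_simpleReflection_of_smul_eq h).symm, by
        rw [h, ← h, inv_smul_smul]
        exact iff_of_true (h ▸ b.isPos_of_mem_support l.2) (b.isPos_of_mem_support k.2)⟩
    have hne_neg : P.root (w • (k : ι)) ≠ -P.root l := fun h => by
      have h0 : (w * simpleReflection b k) • (k : ι) = l := P.root.injective (by
        rw [mul_smul, root_smul, root_simpleReflection_smul_self, ← neg_eq_iff_eq_neg.mpr h,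
          root_smul]
        exact smul_neg _ _)
      have e := mul_simpleReflection_of_smul_eq h0
      rw [mul_simpleReflection_mul_self] at e
      refine hc ⟨by rw [e, simpleReflection_mul_self_mul, ← e], ?_⟩
      rw [← not_iff_not, ← isPos_mul_simpleReflection_smul, h0, ← h0, mul_smul, inv_smul_smul,
        isPos_iff_not_of_root_eq_neg (root_simpleReflection_smul_self b k), not_not]
      exact iff_of_true (by rw [← mul_smul, h0]; exact b.isPos_of_mem_support l.2)
        (b.isPos_of_mem_support k.2)
    have h1 : b.IsPos ((simpleReflection b l * w) • (k : ι)) ↔ b.IsPos (w • (k : ι)) := by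
      rw [mul_smul, isPos_simpleReflection_smul_iff hne hne_neg]
    have h2 : b.IsPos ((w * simpleReflection b k)⁻¹ • (l : ι)) ↔ b.IsPos (w⁻¹ • (l : ι)) := by
      rw [mul_inv_rev, simpleReflection_inv, mul_smul]
      refine isPos_simpleReflection_smul_iff (fun h => hne (by rw [← h, smul_inv_smul]))
        fun h => hne_neg ?_
      rw [← smul_inv_smul w (l : ι), root_smul w (w⁻¹ • (l : ι)), h, root_smul]
      exact (congrArg Neg.neg (smul_neg w (P.root k))).symm ▸ (neg_neg _).symm
    by_cases h : b.IsPos (w • (k : ι)) <;> by_cases h' : b.IsPos (w⁻¹ • (l : ι)) <;>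
      simp only [h, h', h1, h2, rightOp_single_of_isPos, rightOp_single_of_not_isPos,
        leftOp_single_of_isPos, leftOp_single_of_not_isPos, map_add, map_smul, not_false_eq_true,
        mul_assoc, smul_add]
    exact add_add_add_comm _ _ _ _

/-- An operator on the regular module that commutes with all left multiplications is determined by
its value at `v_1`. -/
theorem end_eq_of_commute_leftOp {X Y : End A (P.weylGroup →₀ A)}
    (hX : ∀ k v, leftOp b k (X v) = X (leftOp b k v))
    (hY : ∀ k v, leftOp b k (Y v) = Y (leftOp b k v))
    (h : X (Finsupp.single 1 1) = Y (Finsupp.single 1 1)) : X = Y := by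
  refine Finsupp.lhom_ext' fun w => LinearMap.ext_ring ?_
  simp only [LinearMap.comp_apply, Finsupp.lsingle_apply]
  induction w using weylGroup_induction (b := b) with
  | one => exact h
  | mul k w ih =>
    by_cases hk : b.IsPos (w⁻¹ • (k : ι))
    · rw [← leftOp_single_of_isPos hk, ← hX, ← hY, ih]
    · rw [eq_sub_of_add_eq (leftOp_single_of_not_isPos hk).symm, map_sub, map_sub, map_smul,
        map_smul, ← hX, ← hY, ih]

theorem altProd_succ (k l : b.support) (n : ℕ) :
    altProd b k l (n + 1) = altProd b l k n * FreeAlgebra.ι A l := by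
  simp [altProd, CoxeterSystem.alternatingWord_succ]

variable (b) in
/-- The right regular representation of the free algebra on the simple reflections. -/
abbrev regularRep : FreeAlgebra A b.support →ₐ[A] (End A (P.weylGroup →₀ A))ᵐᵒᵖ :=
  FreeAlgebra.lift A fun k => MulOpposite.op (rightOp b k)

theorem regularRep_altProd (k l : b.support) {n : ℕ} (hn : n ≤ m b k l) :
    (regularRep b (altProd b k l n)).unop (Finsupp.single 1 1) =
      Finsupp.single (altWeyl b k l n) 1 := by
  induction n generalizing k l with
  | zero => simp [altProd, CoxeterSystem.alternatingWord]
  | succ n ih =>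
    rw [altProd_succ, map_mul, MulOpposite.unop_mul, FreeAlgebra.lift_ι_apply, Module.End.mul_apply,
      ih l k (by rw [m_comm]; omega), altWeyl_succ]
    exact rightOp_single_of_isPos (isPos_altWeyl_smul l k (by rw [m_comm]; omega))

theorem regularRep_eq_of_heckeRel {x y : FreeAlgebra A b.support} (h : HeckeRel b x y) :
    regularRep b x = regularRep b y := by
  apply MulOpposite.unop_injective
  induction h with
  | quadratic k =>
    refine LinearMap.ext fun v => ?_
    simp only [map_mul, map_sub, map_add, FreeAlgebra.lift_ι_apply, AlgHom.commutes,
      MulOpposite.unop_mul, MulOpposite.unop_sub, MulOpposite.unop_add, MulOpposite.unop_op,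
      MulOpposite.algebraMap_apply, Module.End.mul_apply, LinearMap.add_apply, LinearMap.sub_apply,
      Module.algebraMap_end_apply, map_sub, map_smul, rightOp_rightOp, map_zero,
      MulOpposite.unop_zero, LinearMap.zero_apply]
    have := qInv_mul_q
    rw [smul_add, smul_smul, this]
    module
  | braid k l hkl =>
    refine end_eq_of_commute_leftOp
      (fun j v => lift_intertwine (π := leftOp b j) (fun k v => leftOp_rightOp k j v) _ v)
      (fun j v => lift_intertwine (π := leftOp b j) (fun k v => leftOp_rightOp k j v) _ v) ?_
    rw [regularRep_altProd k l le_rfl, regularRep_altProd l k (m_comm k l).le, altWeyl_order]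

/-! ### The right action on `𝕋_f` -/

section Action

variable {Xf : Set M} (hX : IsDotInvariant b Xf)

theorem rho_mem_weightLattice : rho b ∈ weightLattice P :=
  mem_weightLattice_of_simple (b := b) fun k => ⟨1, by rw [toLinearMap_rho]; simp⟩

theorem mem_weightLattice_of_mem_shifted (hint : Xf ⊆ weightLattice P) {x : M}
    (hx : x ∈ shifted b Xf) : x ∈ weightLattice P := by
  obtain ⟨μ, hμ, rfl⟩ := hx
  intro i
  obtain ⟨n, hn⟩ := hint hμ i
  obtain ⟨n', hn'⟩ := rho_mem_weightLattice (b := b) i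
  exact ⟨n + n', by rw [map_add, LinearMap.add_apply, hn, hn']; simp⟩

/-- A multiple `z α_k` is a sum of simple roots only if `z ≥ 0`, as its pairing with `ρ^∨` is
`z`. -/
theorem nonneg_of_zsmul_root_mem {k : b.support} {z : ℤ}
    (h : z • P.root k ∈ AddSubmonoid.closure (P.root '' (b.support : Set ι))) : 0 ≤ z := by
  have hrho (j : b.support) : P.toLinearMap (P.root j) (rho b.flip) = 1 :=
    toLinearMap_rho (P := P.flip) (b := b.flip) j
  have key : ∀ y ∈ AddSubmonoid.closure (P.root '' (b.support : Set ι)),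
      ∃ n : ℕ, P.toLinearMap y (rho b.flip) = n := by
    intro y hy
    induction hy using AddSubmonoid.closure_induction with
    | mem y hy =>
      obtain ⟨j, hj, rfl⟩ := hy
      exact ⟨1, by rw [hrho ⟨j, hj⟩]; simp⟩
    | zero => exact ⟨0, by simp⟩
    | add y z _ _ hy hz =>
      obtain ⟨n, hn⟩ := hy
      obtain ⟨n', hn'⟩ := hz
      exact ⟨n + n', by rw [map_add, LinearMap.add_apply, hn, hn']; simp⟩
  obtain ⟨n, hn⟩ := key _ h
  rw [map_zsmul, LinearMap.smul_apply, hrho] at hn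
  have : z = n := by
    rw [zsmul_one] at hn
    exact_mod_cast hn
  omega

theorem prec_simpleReflection_smul_iff {x : M} {k : b.support} {n : ℤ}
    (h : P.toLinearMap x (P.coroot k) = n) :
    Prec b x (simpleReflection b k • x) ↔ n < 0 := by
  rw [Prec, simpleReflection_smul_weight, h, sub_sub_cancel_left, Int.cast_smul_eq_zsmul,
    ← neg_smul]
  constructor
  · rintro ⟨hne, hmem⟩
    have := nonneg_of_zsmul_root_mem hmem
    rcases (show n ≤ 0 by omega).lt_or_eq with h' | rfl
    · exact h'
    · simp at hne
  · intro hn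
    refine ⟨fun e => ?_, ?_⟩
    · rw [eq_comm, sub_eq_self, ← Int.cast_smul_eq_zsmul K, smul_eq_zero] at e
      rcases e with e | e
      · norm_cast at e
        omega
      · exact P.ne_zero _ e
    · obtain ⟨n', hn'⟩ := Int.eq_ofNat_of_zero_le (show 0 ≤ -n by omega)
      rw [hn', natCast_zsmul]
      exact AddSubmonoid.nsmul_mem _ (AddSubmonoid.subset_closure (Set.mem_image_of_mem _ k.2)) _

theorem simpleReflection_smul_eq_self_iff {x : M} {k : b.support} :
    simpleReflection b k • x = x ↔ P.toLinearMap x (P.coroot k) = 0 := by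
  rw [simpleReflection_smul_weight, sub_eq_self, smul_eq_zero, or_iff_left (P.ne_zero _)]

theorem coe_rightAct (x : shifted b Xf) (w : P.weylGroup) :
    (rightAct hX x w : M) = w⁻¹ • (x : M) := rfl

theorem rightAct_mul (x : shifted b Xf) (w w' : P.weylGroup) :
    rightAct hX x (w * w') = rightAct hX (rightAct hX x w) w' :=
  Subtype.ext (by simp [rightAct, mul_smul])

@[simp] theorem rightAct_one (x : shifted b Xf) : rightAct hX x 1 = x :=
  Subtype.ext (by simp [rightAct])

variable {hX}

theorem heckeOp_v_of_eq {x : shifted b Xf} {k : b.support}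
    (h : P.toLinearMap (x : M) (P.coroot k) = 0) :
    rightAct hX x (simpleReflection b k) = x ∧ heckeOp b hX k (v b x) = qInv • v b x := by
  have e : rightAct hX x (simpleReflection b k) = x := Subtype.ext (by
    simpa [rightAct] using simpleReflection_smul_eq_self_iff.mpr h)
  refine ⟨e, ?_⟩
  rw [heckeOp, v, Finsupp.linearCombination_single, one_smul, if_pos e, v]

theorem heckeOp_v_of_ne {x : shifted b Xf} {k : b.support} {n : ℤ}
    (h : P.toLinearMap (x : M) (P.coroot k) = n) (hn : n ≠ 0) :
    heckeOp b hX k (v b x) = if n < 0 then v b (rightAct hX x (simpleReflection b k))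
      else v b (rightAct hX x (simpleReflection b k)) + (qInv - q) • v b x := by
  have e : rightAct hX x (simpleReflection b k) ≠ x := fun e => by
    have := congrArg Subtype.val e
    rw [coe_rightAct, simpleReflection_inv, simpleReflection_smul_eq_self_iff, h] at this
    exact hn (by exact_mod_cast this)
  have hp : Prec b (x : M) (rightAct hX x (simpleReflection b k) : M) ↔ n < 0 := by
    rw [coe_rightAct, simpleReflection_inv]
    exact prec_simpleReflection_smul_iff h
  rw [heckeOp, v, Finsupp.linearCombination_single, one_smul, if_neg e]
  simp only [hp]
  rfl

variable (hX) in
/-- The map `v_w ↦ q^{-e(w)} v_{x w}` from the regular module to `𝕋_f`, where `e(w)` is the length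
of the component of `w` in the stabilizer of `x`. -/
def orbitMap (x : shifted b Xf) : (P.weylGroup →₀ A) →ₗ[A] TModule b Xf :=
  Finsupp.linearCombination A fun w : P.weylGroup =>
    qInv ^ invCount b {i | P.toLinearMap (x : M) (P.coroot i) = 0} w • v b (rightAct hX x w)

theorem orbitMap_single (x : shifted b Xf) (w : P.weylGroup) :
    orbitMap hX x (Finsupp.single w 1) =
      qInv ^ invCount b {i | P.toLinearMap (x : M) (P.coroot i) = 0} w •
        v b (rightAct hX x w) := by
  rw [orbitMap, Finsupp.linearCombination_single, one_smul]

/-- For antidominant `x` the map `orbitMap` intertwines the operators of `H_k`: if `⟨x, w α_k^∨⟩` is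
zero then `s_k` fixes `x w` and `e(w s_k) = e(w) ± 1`, and otherwise its sign tells whether
`w α_k` is positive, and `e(w s_k) = e(w)`. -/
theorem orbitMap_rightOp {x : shifted b Xf} (hx : IsAntidominant b (x : M)) (k : b.support)
    (u : P.weylGroup →₀ A) :
    orbitMap hX x (rightOp b k u) = heckeOp b hX k (orbitMap hX x u) := by
  suffices orbitMap hX x ∘ₗ rightOp b k = heckeOp b hX k ∘ₗ orbitMap hX x from
    LinearMap.congr_fun this u
  refine Finsupp.lhom_ext' fun w => LinearMap.ext_ring ?_
  simp only [LinearMap.comp_apply, Finsupp.lsingle_apply]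
  have hpair (w : P.weylGroup) (i : ι) : P.toLinearMap (rightAct hX x w : M) (P.coroot i) =
      P.toLinearMap (x : M) (P.coroot (w • i)) := (toLinearMap_coroot_smul w _ i).symm
  have hact := rightAct_mul hX x w (simpleReflection b k)
  have hpos := isPos_mul_simpleReflection_smul b w k
  have hinv := invCount_mul_simpleReflection {i | P.toLinearMap (x : M) (P.coroot i) = 0} (w := w)
    (k := k)
  have hinv' := invCount_mul_simpleReflection {i | P.toLinearMap (x : M) (P.coroot i) = 0}
    (w := w * simpleReflection b k) (k := k)
  have hneg : P.toLinearMap (x : M) (P.coroot ((w * simpleReflection b k) • (k : ι))) =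
      -P.toLinearMap (x : M) (P.coroot (w • (k : ι))) := by
    rw [mul_smul, ← hpair, ← hpair, simpleReflection_smul, P.coroot_reflectionPerm,
      P.coreflection_apply_self, map_neg]
  simp only [Set.mem_ofPred_eq, hneg, neg_eq_zero, mul_simpleReflection_mul_self] at hinv hinv'
  by_cases h0 : P.toLinearMap (x : M) (P.coroot (w • (k : ι))) = 0
  · obtain ⟨e, he⟩ := heckeOp_v_of_eq (x := rightAct hX x w) (k := k) ((hpair w k).trans h0)
    rw [if_pos h0] at hinv hinv'
    rw [e] at hact
    rw [orbitMap_single, map_smul, he]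
    by_cases h : b.IsPos (w • (k : ι))
    · rw [rightOp_single_of_isPos h, orbitMap_single, hact, hinv h, pow_succ, mul_smul]
    · rw [rightOp_single_of_not_isPos h, map_add, map_smul, orbitMap_single, orbitMap_single, hact,
        hinv' (hpos.mpr h), smul_smul, smul_smul, ← add_smul]
      congr 1
      linear_combination (-qInv ^ invCount b {i | P.toLinearMap (x : M) (P.coroot i) = 0}
        (w * simpleReflection b k)) * qInv_mul_q
  · rw [if_neg h0, add_zero] at hinv hinv'
    by_cases h : b.IsPos (w • (k : ι))
    · obtain ⟨n, hn, e⟩ := hx _ h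
      have hn0 : n ≠ 0 := fun h' => h0 (by rw [e, h']; simp)
      rw [rightOp_single_of_isPos h, orbitMap_single, orbitMap_single, map_smul,
        heckeOp_v_of_ne ((hpair w k).trans e) hn0, if_pos (by omega), hact, hinv h]
    · obtain ⟨n, hn, e⟩ := hx _ (hpos.mpr h)
      rw [hneg, neg_eq_iff_eq_neg, ← Int.cast_neg] at e
      have hn0 : -n ≠ 0 := fun h' => h0 (by rw [e, h']; simp)
      rw [rightOp_single_of_not_isPos h, map_add, map_smul, orbitMap_single, orbitMap_single,
        map_smul, heckeOp_v_of_ne ((hpair w k).trans e) hn0, if_neg (by omega), hact,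
        hinv' (hpos.mpr h), smul_add, smul_comm]

/-- The operators `heckeOp` satisfy the relations of the Hecke algebra, since the maps from the
regular module attached to antidominant weights are intertwining and jointly surjective. -/
theorem lift_heckeOp_eq_of_heckeRel (hint : Xf ⊆ weightLattice P) {x y : FreeAlgebra A b.support}
    (h : HeckeRel b x y) :
    FreeAlgebra.lift A (fun k => MulOpposite.op (heckeOp b hX k)) x =
      FreeAlgebra.lift A (fun k => MulOpposite.op (heckeOp b hX k)) y := by
  apply MulOpposite.unop_injective
  refine Finsupp.lhom_ext' fun z => LinearMap.ext_ring ?_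
  simp only [LinearMap.comp_apply, Finsupp.lsingle_apply]
  obtain ⟨w, hw⟩ := exists_isAntidominant (b := b) (mem_weightLattice_of_mem_shifted hint z.2)
  let z₀ : shifted b Xf := ⟨w • (z : M), smul_mem_shifted hX w z.2⟩
  have hz : rightAct hX z₀ w = z := Subtype.ext (inv_smul_smul w (z : M))
  have hsurj : Finsupp.single z 1 = orbitMap hX z₀
      (q ^ invCount b {i | P.toLinearMap (z₀ : M) (P.coroot i) = 0} w • Finsupp.single w 1) := by
    rw [map_smul, orbitMap_single, hz, smul_smul, ← mul_pow, mul_comm q, qInv_mul_q, one_pow,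
      one_smul, v]
  have hint' := lift_intertwine (f := fun k => MulOpposite.op (rightOp b k))
    (f' := fun k => MulOpposite.op (heckeOp b hX k)) (orbitMap_rightOp (x := z₀) hw)
  rw [hsurj, ← hint', ← hint', regularRep_eq_of_heckeRel h]

variable (hX) in
/-- The right action of the Hecke algebra on `𝕋_f`. -/
def heckeAction (hint : Xf ⊆ weightLattice P) :
    HeckeAlgebra b →ₐ[A] (End A (TModule b Xf))ᵐᵒᵖ :=
  RingQuot.liftAlgHom A ⟨FreeAlgebra.lift A fun k => MulOpposite.op (heckeOp b hX k),
    fun _ _ h => lift_heckeOp_eq_of_heckeRel hint h⟩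

theorem isHeckeAction_heckeAction (hint : Xf ⊆ weightLattice P) :
    IsHeckeAction hX (heckeAction hX hint) := fun k => by
  rw [heckeAction, H, RingQuot.liftAlgHom_mkAlgHom_apply, FreeAlgebra.lift_ι_apply]

theorem algHom_eq_of_forall_H {B : Type*} [Semiring B] [Algebra A B] {f g : HeckeAlgebra b →ₐ[A] B}
    (h : ∀ k, f (H b k) = g (H b k)) : f = g :=
  RingQuot.ringQuot_ext' _ _ _ (FreeAlgebra.hom_ext (funext h))

end Action

end Regular

section StandardBasis

variable {ι K M N : Type*} [Field K]
  [AddCommGroup M] [Module K M] [AddCommGroup N] [Module K N]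
  {P : RootPairing ι K M N} {b : P.Base} [CharZero K]
  [Finite ι] [P.IsCrystallographic] [P.IsReduced]

/-! ### The standard spanning set of the Hecke algebra -/

/-- The length of `w`: the number of positive roots that `w⁻¹` makes negative. -/
abbrev length (b : P.Base) (w : P.weylGroup) : ℕ := invCount b Set.univ w

theorem length_mul_simpleReflection {w : P.weylGroup} {k : b.support}
    (h : b.IsPos (w • (k : ι))) : length b (w * simpleReflection b k) = length b w + 1 := by
  rw [length, invCount_mul_simpleReflection _ h, if_pos (Set.mem_univ _)]

theorem length_eq_of_not_isPos {w : P.weylGroup} {k : b.support}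
    (h : ¬ b.IsPos (w • (k : ι))) : length b w = length b (w * simpleReflection b k) + 1 := by
  rw [← length_mul_simpleReflection ((isPos_mul_simpleReflection_smul b w k).mpr h),
    mul_simpleReflection_mul_self]

variable (b) in
/-- The element `H_w = H_{k_1} ⋯ H_{k_n}` of the Hecke algebra, for the reduced word `k_1 ⋯ k_n` of
`w` that results from choosing descents. By `heckeT_eq_of_not_isPos` it does not depend on
these choices. -/
def heckeT (w : P.weylGroup) : HeckeAlgebra b :=
  if h : w = 1 then 1
  else heckeT (w * simpleReflection b (exists_descent (b := b) h).choose) *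
    H b (exists_descent (b := b) h).choose
termination_by length b w
decreasing_by
  rw [length_eq_of_not_isPos (exists_descent (b := b) h).choose_spec]
  exact Nat.lt_succ_self _

theorem heckeT_one : heckeT b (1 : P.weylGroup) = 1 := by
  rw [heckeT, dif_pos rfl]

theorem exists_heckeT_eq {w : P.weylGroup} (h : w ≠ 1) :
    ∃ k : b.support, ¬ b.IsPos (w • (k : ι)) ∧
      heckeT b w = heckeT b (w * simpleReflection b k) * H b k :=
  ⟨_, (exists_descent (b := b) h).choose_spec, by rw [heckeT, dif_neg h]⟩

theorem mkAlgHom_altProd_succ (k l : b.support) (n : ℕ) :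
    RingQuot.mkAlgHom A (HeckeRel b) (altProd b k l (n + 1)) =
      RingQuot.mkAlgHom A (HeckeRel b) (altProd b l k n) * H b l := by
  rw [altProd_succ, map_mul, H]

theorem length_mul_altWeyl {u : P.weylGroup} {k l : b.support} (hkl : k ≠ l)
    (hk : b.IsPos (u • (k : ι))) (hl : b.IsPos (u • (l : ι))) {n : ℕ} (hn : n ≤ m b k l) :
    length b (u * altWeyl b k l n) = length b u + n := by
  induction n generalizing k l with
  | zero => simp
  | succ n ih =>
    have hn' : n < m b l k := by rw [m_comm]; omega
    rw [altWeyl_succ, ← mul_assoc, length_mul_simpleReflection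
      (isPos_mul_altWeyl_smul hkl.symm hl hk hn'), ih hkl.symm hl hk hn'.le, add_assoc]

/-- The elements `H_w` can be computed with any descent. This is Matsumoto's theorem for the Weyl
group: two different descents `s_k, s_l` of `w` occur as last letters in the two alternating
words for the longest element of the subgroup generated by `s_k, s_l`, which a braid relation
identifies. -/
theorem heckeT_eq_of_not_isPos {w : P.weylGroup} {k : b.support} (h : ¬ b.IsPos (w • (k : ι))) :
    heckeT b w = heckeT b (w * simpleReflection b k) * H b k := by
  induction hn : length b w using Nat.strong_induction_on generalizing w k with
  | _ n ih =>
  have hw : w ≠ 1 := by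
    rintro rfl
    exact h (by simpa using b.isPos_of_mem_support k.2)
  obtain ⟨j, hj, e⟩ := exists_heckeT_eq (b := b) hw
  by_cases hkj : k = j
  · rwa [hkj]
  -- Up to the last letter the induction hypothesis computes `H` along both alternating words.
  obtain ⟨u, huk, huj, rfl⟩ := exists_eq_mul_altWeyl hkj h hj
  have hlen := length_mul_altWeyl hkj huk huj le_rfl
  have key (r : ℕ) : ∀ (k l : b.support), k ≠ l → b.IsPos (u • (k : ι)) → b.IsPos (u • (l : ι)) →
      r < m b k l → length b u + r < n → heckeT b (u * altWeyl b k l r) =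
        heckeT b u * RingQuot.mkAlgHom A (HeckeRel b) (altProd b k l r) := by
    induction r with
    | zero =>
      intro k l _ _ _ _ _
      simp [altProd, CoxeterSystem.alternatingWord]
    | succ r ihr =>
      intro k l hkl hk hl hr hr'
      have hr2 : r < m b l k := by rw [m_comm]; omega
      have hpos := isPos_mul_altWeyl_smul hkl.symm hl hk hr2
      rw [ih _ (by rw [length_mul_altWeyl hkl hk hl hr.le]; exact hr') (k := l)
          (by rwa [altWeyl_succ, ← mul_assoc, isPos_mul_simpleReflection_smul, not_not]) rfl,
        altWeyl_succ, ← mul_assoc, mul_simpleReflection_mul_self,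
        ihr l k hkl.symm hl hk hr2 (by omega), mul_assoc, mkAlgHom_altProd_succ]
  have last (k l : b.support) (hkl : k ≠ l) (hk : b.IsPos (u • (k : ι)))
      (hl : b.IsPos (u • (l : ι))) (hlen : length b u + m b k l = n) :
      heckeT b (u * altWeyl b k l (m b k l) * simpleReflection b l) * H b l =
        heckeT b u * RingQuot.mkAlgHom A (HeckeRel b) (altProd b k l (m b k l)) := by
    obtain ⟨r, hr⟩ := Nat.exists_eq_add_one.mpr (m_pos k l)
    rw [hr, altWeyl_succ, ← mul_assoc, mul_simpleReflection_mul_self,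
      key r l k hkl.symm hl hk (by rw [m_comm]; omega) (by omega), mul_assoc,
      mkAlgHom_altProd_succ]
  rw [e, last k j hkj huk huj (by omega), altWeyl_order, m_comm k j,
    last j k (Ne.symm hkj) huj huk (by rw [m_comm]; omega), m_comm j k,
    RingQuot.mkAlgHom_rel A (HeckeRel.braid k j hkj)]

theorem heckeT_mul_simpleReflection {w : P.weylGroup} {k : b.support}
    (h : b.IsPos (w • (k : ι))) :
    heckeT b (w * simpleReflection b k) = heckeT b w * H b k := by
  rw [heckeT_eq_of_not_isPos (k := k)
    (by rwa [isPos_mul_simpleReflection_smul, not_not]), mul_simpleReflection_mul_self]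

theorem H_mul_H (k : b.support) : H b k * H b k = 1 + (qInv - q) • H b k := by
  have hfree : FreeAlgebra.ι A k * FreeAlgebra.ι A k =
      (FreeAlgebra.ι A k - algebraMap A _ qInv) * (FreeAlgebra.ι A k + algebraMap A _ q) +
        (1 + (qInv - q) • FreeAlgebra.ι A k) := by
    rw [sub_mul, mul_add, mul_add, ← Algebra.commutes q, ← map_mul, qInv_mul_q, map_one,
      ← Algebra.smul_def, ← Algebra.smul_def]
    module
  rw [H, ← map_mul, hfree, map_add, RingQuot.mkAlgHom_rel A (HeckeRel.quadratic k), map_zero,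
    zero_add, map_add, map_one, map_smul]

variable (b) in
/-- The linear map from the regular module to the Hecke algebra with `v_w ↦ H_w`. -/
def toHecke : (P.weylGroup →₀ A) →ₗ[A] HeckeAlgebra b :=
  Finsupp.linearCombination A (heckeT b)

theorem toHecke_single (w : P.weylGroup) : toHecke b (Finsupp.single w 1) = heckeT b w := by
  rw [toHecke, Finsupp.linearCombination_single, one_smul]

theorem toHecke_rightOp (k : b.support) (u : P.weylGroup →₀ A) :
    toHecke b (rightOp b k u) = toHecke b u * H b k := by
  suffices toHecke b ∘ₗ rightOp b k = LinearMap.mulRight A (H b k) ∘ₗ toHecke b from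
    LinearMap.congr_fun this u
  refine Finsupp.lhom_ext' fun w => LinearMap.ext_ring ?_
  simp only [LinearMap.comp_apply, Finsupp.lsingle_apply, LinearMap.mulRight_apply]
  by_cases h : b.IsPos (w • (k : ι))
  · rw [rightOp_single_of_isPos h, toHecke_single, toHecke_single, heckeT_mul_simpleReflection h]
  · rw [rightOp_single_of_not_isPos h, map_add, map_smul, toHecke_single, toHecke_single,
      heckeT_eq_of_not_isPos h, mul_assoc, H_mul_H, mul_add, mul_one, mul_smul_comm]

theorem toHecke_regularRep (a : FreeAlgebra A b.support) (u : P.weylGroup →₀ A) :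
    toHecke b ((regularRep b a).unop u) =
      toHecke b u * RingQuot.mkAlgHom A (HeckeRel b) a := by
  induction a generalizing u with
  | grade0 r =>
    simp [MulOpposite.algebraMap_apply, Module.algebraMap_end_apply, ← Algebra.commutes,
      ← Algebra.smul_def]
  | grade1 k =>
    rw [FreeAlgebra.lift_ι_apply]
    exact toHecke_rightOp k u
  | mul a c ha hc => simp [ha, hc, mul_assoc]
  | add a c ha hc => simp [ha, hc, mul_add]

/-- The elements `H_w` span the Hecke algebra. -/
theorem toHecke_surjective : Function.Surjective (toHecke b) := fun h => by
  obtain ⟨a, rfl⟩ := RingQuot.mkAlgHom_surjective A (HeckeRel b) h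
  exact ⟨(regularRep b a).unop (Finsupp.single 1 1), by
    rw [toHecke_regularRep, toHecke_single, heckeT_one, one_mul]⟩

/-- The regular module is generated by `v_1`, so that an intertwining map is determined by its value
at `v_1`. -/
theorem linearMap_eq_of_intertwine {V : Type*} [AddCommGroup V] [Module A V]
    {π π' : (P.weylGroup →₀ A) →ₗ[A] V} {f : b.support → End A V}
    (h : ∀ k u, π (rightOp b k u) = f k (π u)) (h' : ∀ k u, π' (rightOp b k u) = f k (π' u))
    (h1 : π (Finsupp.single 1 1) = π' (Finsupp.single 1 1)) : π = π' := by
  suffices ∀ w : P.weylGroup, π (Finsupp.single w⁻¹ 1) = π' (Finsupp.single w⁻¹ 1) from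
    Finsupp.lhom_ext' fun w => LinearMap.ext_ring (by simpa using this w⁻¹)
  intro w
  induction w using weylGroup_induction (b := b) with
  | one => simpa using h1
  | mul k w ih =>
    rw [mul_inv_rev, simpleReflection_inv]
    by_cases hk : b.IsPos (w⁻¹ • (k : ι))
    · rw [← rightOp_single_of_isPos hk, h, h', ih]
    · rw [eq_sub_of_add_eq (rightOp_single_of_not_isPos hk).symm, map_sub, map_sub, map_smul,
        map_smul, h, h', ih]

/-! ### Regular orbits -/

section RegularOrbit

variable {Xf : Set M} {hX : IsDotInvariant b Xf}

theorem exists_isAntidominant_regular (hX : IsDotInvariant b Xf) (hint : Xf ⊆ weightLattice P)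
    (hreg : ∃ μ ∈ Xf, IsDotRegular b μ) :
    ∃ x : shifted b Xf, IsAntidominant b (x : M) ∧
      ∀ w : P.weylGroup, w • (x : M) = x → w = 1 := by
  obtain ⟨μ, hμ, h⟩ := hreg
  have hmem : μ + rho b ∈ shifted b Xf := ⟨μ, hμ, rfl⟩
  obtain ⟨w₀, hw₀⟩ := exists_isAntidominant (b := b) (mem_weightLattice_of_mem_shifted hint hmem)
  refine ⟨⟨w₀ • (μ + rho b), smul_mem_shifted hX w₀ hmem⟩, hw₀, fun w hw => ?_⟩
  have := h (w₀⁻¹ * w * w₀) (by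
    change w • w₀ • (μ + rho b) = w₀ • (μ + rho b) at hw
    rw [dot, mul_smul, mul_smul, hw, inv_smul_smul, add_sub_cancel_right])
  rwa [mul_assoc, inv_mul_eq_one, eq_comm, mul_eq_right] at this

variable (hX) in
/-- The left inverse of `orbitMap` for a regular orbit: it sends `v_{x w}` to `v_w`, and `v_z` to
`0` for `z` outside the orbit of `x`. -/
def orbitRetraction (x : shifted b Xf) : TModule b Xf →ₗ[A] (P.weylGroup →₀ A) :=
  Finsupp.linearCombination A fun z =>
    if h : ∃ w, rightAct hX x w = z then Finsupp.single h.choose 1 else 0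

theorem orbitRetraction_v_of_not {x z : shifted b Xf} (h : ¬ ∃ w, rightAct hX x w = z) :
    orbitRetraction hX x (v b z) = 0 := by
  rw [orbitRetraction, v, Finsupp.linearCombination_single, dif_neg h, smul_zero]

variable {x : shifted b Xf} (hreg : ∀ w : P.weylGroup, w • (x : M) = x → w = 1)

include hreg

theorem orbitMap_single_of_regular (w : P.weylGroup) :
    orbitMap hX x (Finsupp.single w 1) = v b (rightAct hX x w) := by
  have hS : {i | P.toLinearMap (x : M) (P.coroot i) = 0} = ∅ := by
    refine Set.eq_empty_of_forall_notMem fun i hi => ?_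
    have h1 : RootPairing.weylGroup.ofIdx P i = 1 := hreg _ (by
      rw [ofIdx_smul_weight, show P.toLinearMap (x : M) (P.coroot i) = 0 from hi, zero_smul,
        sub_zero])
    have h2 : RootPairing.weylGroup.ofIdx P i • P.root i = -P.root i := P.reflection_apply_self i
    rw [h1, one_smul] at h2
    have h3 := congrArg (fun y => P.toLinearMap y (P.coroot i)) h2
    simp only [map_neg, LinearMap.neg_apply, P.root_coroot_two] at h3
    norm_num at h3
  rw [orbitMap_single, hS]
  simp [invCount]

theorem orbitRetraction_v_rightAct (w : P.weylGroup) :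
    orbitRetraction hX x (v b (rightAct hX x w)) = Finsupp.single w 1 := by
  have h : ∃ w', rightAct hX x w' = rightAct hX x w := ⟨w, rfl⟩
  rw [orbitRetraction, v, Finsupp.linearCombination_single, dif_pos h, one_smul]
  congr 1
  have e := congrArg Subtype.val h.choose_spec
  rw [coe_rightAct, coe_rightAct, ← eq_inv_smul_iff, inv_inv, smul_smul, eq_comm] at e
  exact (mul_inv_eq_one.mp (hreg _ e))

theorem orbitRetraction_orbitMap (u : P.weylGroup →₀ A) :
    orbitRetraction hX x (orbitMap hX x u) = u := by
  suffices orbitRetraction hX x ∘ₗ orbitMap hX x = LinearMap.id from LinearMap.congr_fun this u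
  refine Finsupp.lhom_ext' fun w => LinearMap.ext_ring ?_
  simp only [LinearMap.comp_apply, Finsupp.lsingle_apply, LinearMap.id_apply]
  rw [orbitMap_single_of_regular hreg, orbitRetraction_v_rightAct hreg]

theorem orbitRetraction_heckeOp (hint : Xf ⊆ weightLattice P) (hx : IsAntidominant b (x : M))
    (k : b.support) (y : TModule b Xf) :
    orbitRetraction hX x (heckeOp b hX k y) = rightOp b k (orbitRetraction hX x y) := by
  suffices orbitRetraction hX x ∘ₗ heckeOp b hX k = rightOp b k ∘ₗ orbitRetraction hX x from
    LinearMap.congr_fun this y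
  refine Finsupp.lhom_ext' fun z => LinearMap.ext_ring ?_
  simp only [LinearMap.comp_apply, Finsupp.lsingle_apply]
  change orbitRetraction hX x (heckeOp b hX k (v b z)) =
    rightOp b k (orbitRetraction hX x (v b z))
  by_cases hz : ∃ w, rightAct hX x w = z
  · obtain ⟨w, rfl⟩ := hz
    rw [orbitRetraction_v_rightAct hreg, ← orbitMap_single_of_regular hreg, ← orbitMap_rightOp hx,
      orbitRetraction_orbitMap hreg]
  · have hz' : ¬ ∃ w, rightAct hX x w = rightAct hX z (simpleReflection b k) := by
      rintro ⟨w, hw⟩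
      refine hz ⟨w * simpleReflection b k, ?_⟩
      rw [rightAct_mul, hw, ← rightAct_mul, simpleReflection_mul_self, rightAct_one]
    rw [orbitRetraction_v_of_not hz, map_zero]
    obtain ⟨n, hn⟩ := mem_weightLattice_of_mem_shifted hint z.2 k
    by_cases hn0 : n = 0
    · rw [(heckeOp_v_of_eq (hn.trans (by simp [hn0]))).2, map_smul, orbitRetraction_v_of_not hz,
        smul_zero]
    · rw [heckeOp_v_of_ne hn hn0]
      split_ifs
      · rw [orbitRetraction_v_of_not hz']
      · rw [map_add, map_smul, orbitRetraction_v_of_not hz, orbitRetraction_v_of_not hz',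
          smul_zero, add_zero]

end RegularOrbit

/-! ### Faithfulness and the double centralizer property -/

section Duality

variable {Xf : Set M} {hX : IsDotInvariant b Xf}
  {Ψ : HeckeAlgebra b →ₐ[A] (End A (TModule b Xf))ᵐᵒᵖ} (hΨ : IsHeckeAction hX Ψ)

/-- The linear map from the regular module to `𝕋_f` with `v_w ↦ y H_w`. -/
def cyclicMap (Ψ : HeckeAlgebra b →ₐ[A] (End A (TModule b Xf))ᵐᵒᵖ) (y : TModule b Xf) :
    (P.weylGroup →₀ A) →ₗ[A] TModule b Xf :=
  LinearMap.applyₗ y ∘ₗ (MulOpposite.opLinearEquiv A).symm.toLinearMap ∘ₗ Ψ.toLinearMap ∘ₗ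
    toHecke b

theorem cyclicMap_apply (y : TModule b Xf) (u : P.weylGroup →₀ A) :
    cyclicMap Ψ y u = (Ψ (toHecke b u)).unop y := rfl

theorem cyclicMap_one (y : TModule b Xf) : cyclicMap Ψ y (Finsupp.single 1 1) = y := by
  simp [cyclicMap_apply, toHecke_single, heckeT_one]

include hΨ

theorem cyclicMap_rightOp (y : TModule b Xf) (k : b.support) (u : P.weylGroup →₀ A) :
    cyclicMap Ψ y (rightOp b k u) = heckeOp b hX k (cyclicMap Ψ y u) := by
  rw [cyclicMap_apply, toHecke_rightOp, map_mul, hΨ k]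
  rfl

theorem action_injective (hint : Xf ⊆ weightLattice P) (hreg : ∃ μ ∈ Xf, IsDotRegular b μ) :
    Function.Injective Ψ := by
  obtain ⟨x, hx, hreg⟩ := exists_isAntidominant_regular hX hint hreg
  have e : cyclicMap Ψ (v b x) = orbitMap hX x :=
    linearMap_eq_of_intertwine (cyclicMap_rightOp hΨ _) (orbitMap_rightOp hx) (by
      rw [cyclicMap_one, orbitMap_single_of_regular hreg, rightAct_one])
  refine (injective_iff_map_eq_zero _).mpr fun h hh => ?_
  obtain ⟨u, rfl⟩ := toHecke_surjective h
  have h0 : orbitMap hX x u = 0 := by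
    rw [← e, cyclicMap_apply, hh]
    rfl
  rw [← orbitRetraction_orbitMap (hX := hX) hreg u, h0, map_zero, map_zero]

theorem mem_qSchurAlgebra_of_commute {φ : End A (TModule b Xf)}
    (h : ∀ k y, φ (heckeOp b hX k y) = heckeOp b hX k (φ y)) : φ ∈ qSchurAlgebra Ψ := by
  rw [qSchurAlgebra, Subalgebra.mem_centralizer_iff]
  rintro _ ⟨a, rfl⟩
  obtain ⟨a, rfl⟩ := RingQuot.mkAlgHom_surjective A (HeckeRel b) a
  have hlift : Ψ (RingQuot.mkAlgHom A (HeckeRel b) a) =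
      FreeAlgebra.lift A (fun k => MulOpposite.op (heckeOp b hX k)) a := by
    have : Ψ.comp (RingQuot.mkAlgHom A (HeckeRel b)) =
        FreeAlgebra.lift A (fun k => MulOpposite.op (heckeOp b hX k)) :=
      FreeAlgebra.hom_ext (funext fun k => by
        rw [Function.comp_apply, Function.comp_apply, FreeAlgebra.lift_ι_apply]
        exact hΨ k)
    exact DFunLike.congr_fun this a
  rw [hlift]
  exact (LinearMap.ext fun y => lift_intertwine (π := φ) h a y).symm

/-- The double centralizer property. For `x` in a regular orbit there is, for every `y`, an
endomorphism of the Hecke module `𝕋_f` sending `v_x` to `y`: the composite of the projection onto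
the orbit of `x`, which is a copy of the regular module, with `v_w ↦ y H_w`. An endomorphism that
commutes with all of these is determined by its value at `v_x`, and hence acts as an element of the
Hecke algebra. -/
theorem endOverSchur_eq (hint : Xf ⊆ weightLattice P) (hreg : ∃ μ ∈ Xf, IsDotRegular b μ) :
    endOverSchur Ψ = Ψ.range.unop := by
  obtain ⟨x, hx, hreg⟩ := exists_isAntidominant_regular hX hint hreg
  refine le_antisymm (fun θ hθ => ?_) fun θ hθ => ?_
  · rw [endOverSchur, Subalgebra.mem_centralizer_iff] at hθ
    refine ⟨toHecke b (orbitRetraction hX x (θ (v b x))), MulOpposite.unop_injective ?_⟩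
    refine LinearMap.ext fun y => ?_
    have hmem : cyclicMap Ψ y ∘ₗ orbitRetraction hX x ∈ qSchurAlgebra Ψ :=
      mem_qSchurAlgebra_of_commute hΨ fun k z => by
        rw [LinearMap.comp_apply, orbitRetraction_heckeOp hreg hint hx, cyclicMap_rightOp hΨ,
          LinearMap.comp_apply]
    have e := LinearMap.congr_fun (hθ _ hmem) (v b x)
    have h1 : orbitRetraction hX x (v b x) = Finsupp.single 1 1 := by
      simpa using orbitRetraction_v_rightAct (hX := hX) hreg 1
    rw [Module.End.mul_apply, Module.End.mul_apply, LinearMap.comp_apply, LinearMap.comp_apply, h1,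
      cyclicMap_one] at e
    exact e
  · obtain ⟨h, hh⟩ := hθ
    rw [endOverSchur, Subalgebra.mem_centralizer_iff]
    intro φ hφ
    exact ((Subalgebra.mem_centralizer_iff A).mp hφ θ ⟨h, (congrArg MulOpposite.unop hh).symm⟩).symm

end Duality

end StandardBasis

end QSchur

end

theorem mainTheorem1 {𝔤 : Type*} [LieRing 𝔤] [LieAlgebra ℂ 𝔤] [FiniteDimensional ℂ 𝔤]
    [LieAlgebra.IsSimple ℂ 𝔤] (𝔥 : LieSubalgebra ℂ 𝔤) [𝔥.IsCartanSubalgebra]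
    (b : (LieAlgebra.IsKilling.rootSystem 𝔥).Base)
    (Xf : Set (Module.Dual ℂ 𝔥)) (hfin : Xf.Finite)
    (hint : Xf ⊆ QSchur.weightLattice (LieAlgebra.IsKilling.rootSystem 𝔥))
    (hdot : QSchur.IsDotInvariant b Xf)
    (hreg : ∃ μ ∈ Xf, QSchur.IsDotRegular b μ) :
    ∃ Ψ : QSchur.HeckeAlgebra b →ₐ[QSchur.A] (Module.End QSchur.A (QSchur.TModule b Xf))ᵐᵒᵖ,
      QSchur.IsHeckeAction hdot Ψ ∧
      (∀ Ψ' : QSchur.HeckeAlgebra b →ₐ[QSchur.A]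
          (Module.End QSchur.A (QSchur.TModule b Xf))ᵐᵒᵖ,
        QSchur.IsHeckeAction hdot Ψ' → Ψ' = Ψ) ∧
      QSchur.endOverSchur Ψ = Ψ.range.unop ∧
      Function.Injective Ψ := by
  have hΨ := QSchur.isHeckeAction_heckeAction (hX := hdot) hint
  exact ⟨_, hΨ, fun Ψ' hΨ' => QSchur.algHom_eq_of_forall_H fun k => (hΨ' k).trans (hΨ k).symm,
    QSchur.endOverSchur_eq hΨ hint hreg, QSchur.action_injective hΨ hint hreg⟩
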